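/- Let $V=\mathfrak g^*$ be a real vector space of finite dimension $s$ with a lattice $\Lambda$ (the character lattice of a compact torus $G$), and let $X$ be a finite list of non-zero vectors of $\Lambda$ that spans $V$. For a subspace $\underline r\subset V$ let $X\cap\underline r$ and $X\setminus\underline r$ be the sublists of the vectors of $X$ that lie, respectively do not lie, in $\underline r$; $\underline r$ is rational if it is spanned by $X\cap\underline r$. Let $\mathcal S_X$ be the set of rational subspaces and $\mathcal S_X(k)$ the set of those of dimension $k$. For a list $Y$ of vectors put $\partial_Y=\prod_{a\in Y}\partial_a$, where $\partial_a$ is the derivative in the direction $a$. Let $\mathcal S'(V,\underline r)$ be the image of the space $\mathcal S'(\underline r)$ of tempered distributions on $\underline r$ in $\mathcal S'(V)$ under $j(h)(\varphi)=h(\varphi|_{\underline r})$. Put $$\mathcal G(X)=\{f\in\mathcal S'(V)\mid \partial_{X\setminus\underline r}f\in\mathcal S'(V,\underline r)\text{ for all }\underline r\in\mathcal S_X\},\qquad \mathcal G(X)_i=\mathcal G(X)\cap\bigcap_{\underline t\in\mathcal S_X(i-1)}\ker\partial_{X\setminus\underline t},$$ so that $\mathcal G(X)_0=\mathcal G(X)$.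 For $\underline r\in\mathcal S_X$ let $D(X\cap\underline r)$ be the space of polynomial functions $g$ on $\underline r$ such that $\partial_Yg=0$ for every $Y=(X\cap\underline r)\setminus H$ with $H$ a hyperplane of $\underline r$ spanned by $X\cap H$. Such a $g$ is identified with the distribution $\varphi\mapsto\int_{\underline r}\varphi\,g\,dy$ in $\mathcal S'(V,\underline r)$, where $dy$ is the Lebesgue measure on $\underline r$ for which $\Lambda\cap\underline r$ has covolume $1$. (Functions and distributions may be taken real or complex; the theorem holds in both cases.) For a list $Z=(z_1,\dots,z_m)$ contained in an open half-space (with boundary through $0$) let $T_Z$ be the multivariate spline $\langle T_Z\mid \varphi\rangle=\int_0^\infty\cdots\int_0^\infty \varphi(\sum_j t_jz_j)\,dt_1\cdots dt_m$. For a list $Z$ of non-zero vectors, a regular face $F$ for $Z$ is a connected component of $\{u\in\mathfrak g\mid \langle u,a\rangle\neq0\text{ for all }a\in Z\}$; if $A$, $B$ are the sublists of $Z$ on which $F$ is positive, respectively negative, put $T_Z^F=(-1)^{|B|}T_{(A,-B)}$. **Theorem.** Let $0\le i\le s$, and for every $\underline r\in\mathcal S_X(i)$ choose a regular face $F_{\underline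 r}$ for $X\setminus\underline r$ that contains an element vanishing on $\underline r$ (equivalently, a connected component of the complement in $\underline r^\perp\subset\mathfrak g$ of the hyperplanes $a^\perp\cap\underline r^\perp$, $a\in X\setminus\underline r$). Then $\mathcal G(X)_{i+1}\subset\mathcal G(X)_i$, and $\mu_i f=\oplus_{\underline r}\,\partial_{X\setminus\underline r}f$ is a well-defined linear map $\mathcal G(X)_i\to\oplus_{\underline r\in\mathcal S_X(i)}D(X\cap\underline r)$. The convolutions $T^{F_{\underline r}}_{X\setminus\underline r}*g$ with $g\in D(X\cap\underline r)$, given by the absolutely convergent integrals $$\langle T^{F_{\underline r}}_{X\setminus\underline r}*g\mid\varphi\rangle=(-1)^{|B|}\int_V\int_{\underline r}\varphi(x+y)\,g(y)\,dy\,dT_{(A,-B)}(x)\qquad(\varphi\text{ a Schwartz function}),$$ where $X\setminus\underline r=A\cup B$ is the decomposition given by $F_{\underline r}$, define a linear map $\mathbf P_i(\oplus g_{\underline r})=\sum_{\underline r} T^{F_{\underline r}}_{X\setminus\underline r}*g_{\underline r}$ from $\oplus_{\underline r\in\mathcal S_X(i)}D(X\cap\underline r)$ to $\mathcal G(X)_i$.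 The sequence $$0\longrightarrow\mathcal G(X)_{i+1}\longrightarrow\mathcal G(X)_i\xrightarrow{\ \mu_i\ }\bigoplus_{\underline r\in\mathcal S_X(i)}D(X\cap\underline r)\longrightarrow0$$ is exact, and $\mathbf P_i$ splits it: $\mu_i\mathbf P_i=\mathrm{Id}$. -/

import Mathlib

open MeasureTheory SchwartzMap

noncomputable section SplineSpaces

namespace SplineSeq

/-! ### Tempered distributions with real or complex values -/

section Distributions

variable (𝕜 : Type*) [RCLike 𝕜] {V : Type*} [NormedAddCommGroup V] [NormedSpace ℝ V]

variable (V) in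
/-- Tempered distributions on `V`: continuous linear functionals on the Schwartz space `𝓢(V, 𝕜)`,
where `𝕜` is `ℝ` or `ℂ`. For `𝕜 = ℂ` this is Mathlib's `TemperedDistribution V ℂ`. -/
abbrev TempDist : Type _ := 𝓢(V, 𝕜) →Lₚₜ[𝕜] 𝕜

/-- The derivative of distributions in the direction `a`: `(∂_a f)(φ) = f (-∂_a φ)`. -/
def distDeriv (a : V) : TempDist 𝕜 V →ₗ[𝕜] TempDist 𝕜 V :=
  (PointwiseConvergenceCLM.precomp 𝕜
    (-LineDeriv.lineDerivOpCLM 𝕜 𝓢(V, 𝕜) a) : TempDist 𝕜 V →L[𝕜] TempDist 𝕜 V)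

/-- The differential operator `∂_Y = ∏_{a ∈ Y} ∂_a` on distributions, for a list `Y`. -/
def distDerivList (Y : List V) : TempDist 𝕜 V →ₗ[𝕜] TempDist 𝕜 V :=
  (Y.map (distDeriv 𝕜)).prod

/-- Restriction of Schwartz functions on `V` to a linear subspace `r`. -/
def restrictSchwartz (r : Submodule ℝ V) : 𝓢(V, 𝕜) →L[𝕜] 𝓢(r, 𝕜) :=
  SchwartzMap.compCLMOfAntilipschitz (K := 1) (g := (r.subtypeL : r → V)) 𝕜
    r.subtypeL.hasTemperateGrowth (fun x y => by simp [Subtype.edist_eq])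

@[simp]
theorem restrictSchwartz_apply (r : Submodule ℝ V) (φ : 𝓢(V, 𝕜)) (y : r) :
    restrictSchwartz 𝕜 r φ y = φ (y : V) := rfl

/-- The image of the embedding `j : 𝓢'(r) → 𝓢'(V)`, `j(h)(φ) = h(φ|_r)`. -/
def distOnSubspace (r : Submodule ℝ V) : Submodule 𝕜 (TempDist 𝕜 V) :=
  LinearMap.range
    ((PointwiseConvergenceCLM.precomp 𝕜 (restrictSchwartz 𝕜 r) :
      TempDist 𝕜 r →L[𝕜] TempDist 𝕜 V) : TempDist 𝕜 r →ₗ[𝕜] TempDist 𝕜 V)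

end Distributions

/-! ### Rational subspaces and cocircuits of a list of vectors -/

section Lists

variable {V : Type*} [AddCommGroup V] [Module ℝ V]

open Classical in
/-- The sublist `X ∖ r` of the vectors of `X` that do not lie in `r`. -/
def listDiff (X : List V) (r : Submodule ℝ V) : List V := X.filter (fun a => a ∉ r)

open Classical in
/-- The sublist `X ∩ r` of the vectors of `X` that lie in `r`, as a list of vectors of `r`. -/
def listInter (X : List V) (r : Submodule ℝ V) : List r :=
  X.filterMap (fun a => if h : a ∈ r then some ⟨a, h⟩ else none)

/-- `r` is rational relative to `X`: it is spanned by the vectors of `X` that it contains. -/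
def IsRational (X : List V) (r : Submodule ℝ V) : Prop :=
  r = Submodule.span ℝ {a | a ∈ X ∧ a ∈ r}

/-- The rational subspaces of dimension `k`. -/
def rationalSubspaces (X : List V) (k : ℕ) : Set (Submodule ℝ V) :=
  {r | IsRational X r ∧ Module.finrank ℝ r = k}

theorem finite_rationalSubspaces (X : List V) (k : ℕ) : (rationalSubspaces X k).Finite := by
  refine Set.Finite.subset (((X.finite_toSet).finite_subsets).image (Submodule.span ℝ)) ?_
  rintro r ⟨hr, -⟩
  exact ⟨{a | a ∈ X ∧ a ∈ r}, fun a ha => ha.1, hr.symm⟩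

instance instFintypeRationalSubspaces (X : List V) (k : ℕ) : Fintype (rationalSubspaces X k) :=
  (finite_rationalSubspaces X k).fintype

/-- The cocircuits of `X`: the sublists `X ∖ H` with `H` a rational hyperplane. -/
def IsCocircuit (X Y : List V) : Prop :=
  ∃ H : Submodule ℝ V,
    IsRational X H ∧ Module.finrank ℝ H + 1 = Module.finrank ℝ V ∧ Y = listDiff X H

end Lists

/-! ### Polynomial functions and the space `D(X)` -/

section Polynomials

variable (𝕜 : Type*) [RCLike 𝕜] {W : Type*} [NormedAddCommGroup W] [NormedSpace ℝ W]

variable (W) in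
/-- The `𝕜`-valued polynomial functions on `W`: the algebra of functions generated by the
(continuous) real linear functionals. -/
def polyFun : Subalgebra 𝕜 (W → 𝕜) :=
  Algebra.adjoin 𝕜 (Set.range fun (l : W →L[ℝ] ℝ) (x : W) => ((l x : ℝ) : 𝕜))

/-- The derivative of a function in the direction `a`. -/
def dirDeriv (a : W) (f : W → 𝕜) : W → 𝕜 := fun x => fderiv ℝ f x a

/-- The operator `∂_Y = ∏_{a ∈ Y} ∂_a` on functions, for a list `Y`. -/
def dirDerivList (Y : List W) (f : W → 𝕜) : W → 𝕜 := Y.foldr (dirDeriv 𝕜) f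

variable {𝕜}

theorem polyFun_aux {f : W → 𝕜} (hf : f ∈ polyFun 𝕜 W) :
    Differentiable ℝ f ∧ ∀ a, dirDeriv 𝕜 a f ∈ polyFun 𝕜 W := by
  have hmem : ∀ {g : W → 𝕜}, g ∈ Algebra.adjoin 𝕜
      (Set.range fun (l : W →L[ℝ] ℝ) (x : W) => ((l x : ℝ) : 𝕜)) → g ∈ polyFun 𝕜 W := id
  induction hf using Algebra.adjoin_induction with
  | mem f hf =>
    obtain ⟨l, rfl⟩ := hf
    have h : (fun x => ((l x : ℝ) : 𝕜)) = fun x => (RCLike.ofRealCLM.comp l : W →L[ℝ] 𝕜) x := by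
      ext x; simp
    constructor
    · change Differentiable ℝ (fun x => ((l x : ℝ) : 𝕜))
      rw [h]; exact (RCLike.ofRealCLM.comp l : W →L[ℝ] 𝕜).differentiable
    · intro a
      have : dirDeriv 𝕜 a (fun x => ((l x : ℝ) : 𝕜))
          = algebraMap 𝕜 (W → 𝕜) ((l a : ℝ) : 𝕜) := by
        ext x
        rw [dirDeriv, h, ContinuousLinearMap.fderiv]
        simp
      change dirDeriv 𝕜 a (fun x => ((l x : ℝ) : 𝕜)) ∈ _
      rw [this]
      exact Subalgebra.algebraMap_mem _ _
  | algebraMap c =>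
    constructor
    · exact differentiable_const c
    · intro a
      have : dirDeriv 𝕜 a (algebraMap 𝕜 (W → 𝕜) c) = 0 := by
        ext x
        have h : (algebraMap 𝕜 (W → 𝕜) c) = fun _ : W => c := rfl
        rw [dirDeriv, h]; simp
      rw [this]; exact Subalgebra.zero_mem _
  | add f g hf hg ihf ihg =>
    refine ⟨ihf.1.add ihg.1, fun a => ?_⟩
    have : dirDeriv 𝕜 a (f + g) = dirDeriv 𝕜 a f + dirDeriv 𝕜 a g := by
      ext x; simp [dirDeriv, fderiv_add (ihf.1 x) (ihg.1 x)]
    rw [this]; exact Subalgebra.add_mem _ (ihf.2 a) (ihg.2 a)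
  | mul f g hf hg ihf ihg =>
    refine ⟨ihf.1.mul ihg.1, fun a => ?_⟩
    have : dirDeriv 𝕜 a (f * g) = f * dirDeriv 𝕜 a g + g * dirDeriv 𝕜 a f := by
      ext x; simp [dirDeriv, fderiv_mul (ihf.1 x) (ihg.1 x)]
    rw [this]
    exact Subalgebra.add_mem _ (Subalgebra.mul_mem _ (hmem hf) (ihg.2 a))
      (Subalgebra.mul_mem _ (hmem hg) (ihf.2 a))

theorem dirDerivList_mem {f : W → 𝕜} (hf : f ∈ polyFun 𝕜 W) (Y : List W) :
    dirDerivList 𝕜 Y f ∈ polyFun 𝕜 W := by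
  induction Y with
  | nil => exact hf
  | cons a Y ih => exact (polyFun_aux ih).2 a

theorem dirDerivList_add {f g : W → 𝕜} (hf : f ∈ polyFun 𝕜 W) (hg : g ∈ polyFun 𝕜 W)
    (Y : List W) : dirDerivList 𝕜 Y (f + g) = dirDerivList 𝕜 Y f + dirDerivList 𝕜 Y g := by
  induction Y with
  | nil => rfl
  | cons a Y ih =>
    change dirDeriv 𝕜 a (dirDerivList 𝕜 Y (f + g))
      = dirDeriv 𝕜 a (dirDerivList 𝕜 Y f) + dirDeriv 𝕜 a (dirDerivList 𝕜 Y g)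
    rw [ih]
    ext x
    simp [dirDeriv, fderiv_add ((polyFun_aux (dirDerivList_mem hf Y)).1 x)
      ((polyFun_aux (dirDerivList_mem hg Y)).1 x)]

theorem dirDerivList_smul {f : W → 𝕜} (hf : f ∈ polyFun 𝕜 W) (c : 𝕜)
    (Y : List W) : dirDerivList 𝕜 Y (c • f) = c • dirDerivList 𝕜 Y f := by
  induction Y with
  | nil => rfl
  | cons a Y ih =>
    change dirDeriv 𝕜 a (dirDerivList 𝕜 Y (c • f)) = c • dirDeriv 𝕜 a (dirDerivList 𝕜 Y f)
    rw [ih]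
    ext x
    simp [dirDeriv, fderiv_const_smul ((polyFun_aux (dirDerivList_mem hf Y)).1 x) c]

variable (𝕜)

/-- The space `D(Z)` of the polynomial functions `g` with `∂_Y g = 0` for every cocircuit `Y`
of `Z`. -/
def polyD (Z : List W) : Submodule 𝕜 (W → 𝕜) where
  carrier := {g | g ∈ polyFun 𝕜 W ∧ ∀ Y, IsCocircuit Z Y → dirDerivList 𝕜 Y g = 0}
  zero_mem' := by
    refine ⟨Subalgebra.zero_mem _, fun Y _ => ?_⟩
    have h := dirDerivList_smul (𝕜 := 𝕜) (f := (0 : W → 𝕜)) (Subalgebra.zero_mem _) 0 Y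
    simpa using h
  add_mem' := fun {f g} hf hg => by
    refine ⟨Subalgebra.add_mem _ hf.1 hg.1, fun Y hY => ?_⟩
    rw [dirDerivList_add hf.1 hg.1, hf.2 Y hY, hg.2 Y hY, add_zero]
  smul_mem' := fun c f hf => by
    refine ⟨Subalgebra.smul_mem _ hf.1 c, fun Y hY => ?_⟩
    rw [dirDerivList_smul hf.1, hf.2 Y hY, smul_zero]

end Polynomials

/-! ### The spaces `𝒢(X)` and `𝒢(X)_i` -/

section SpacesG

variable (𝕜 : Type*) [RCLike 𝕜] {V : Type*} [NormedAddCommGroup V] [NormedSpace ℝ V]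

/-- `𝒢(X)`: the tempered distributions `f` on `V` with `∂_{X ∖ r} f ∈ 𝓢'(V, r)` for every
rational subspace `r`. -/
def spaceG (X : List V) : Submodule 𝕜 (TempDist 𝕜 V) :=
  ⨅ (r : Submodule ℝ V) (_ : IsRational X r),
    (distOnSubspace 𝕜 r).comap (distDerivList 𝕜 (listDiff X r))

/-- `𝒢(X)_i`: the elements of `𝒢(X)` killed by `∂_{X ∖ t}` for every rational subspace `t` of
dimension `i - 1` (no condition if `i = 0`). -/
def spaceGi (X : List V) (i : ℕ) : Submodule 𝕜 (TempDist 𝕜 V) :=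
  spaceG 𝕜 X ⊓ ⨅ (t : Submodule ℝ V) (_ : IsRational X t ∧ Module.finrank ℝ t + 1 = i),
    LinearMap.ker (distDerivList 𝕜 (listDiff X t))

end SpacesG

/-! ### Splines, regular faces and convolutions -/

section Splines

variable {V : Type*} [NormedAddCommGroup V] [NormedSpace ℝ V]

/-- The regular faces of a list `Z`: the connected components of the set of linear functionals
that do not vanish on any vector of `Z`. -/
def IsRegularFace (Z : List V) (F : Set (StrongDual ℝ V)) : Prop :=
  ∃ u ∈ {u : StrongDual ℝ V | ∀ a ∈ Z, u a ≠ 0},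
    F = connectedComponentIn {u : StrongDual ℝ V | ∀ a ∈ Z, u a ≠ 0} u

open Classical in
/-- The sign of a vector `a` on `F`: `1` if all functionals in `F` are positive on `a`,
and `-1` otherwise. For a regular face `F` of a list `Z` and `a ∈ Z`, the second case means that
all functionals in `F` are negative on `a`. -/
def faceSign (F : Set (StrongDual ℝ V)) (a : V) : ℝ := if ∀ u ∈ F, 0 < u a then 1 else -1

/-- The list `(A, -B)`, in the order of `Z`, where `Z = A ∪ B` is the decomposition of `Z` into
the vectors that are positive and those that are negative on `F`. -/
def signedList (Z : List V) (F : Set (StrongDual ℝ V)) : List V :=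
  Z.map (fun a => faceSign F a • a)

variable [MeasurableSpace V]

/-- The multivariate spline `T_Z` as a measure on `V`: the image of Lebesgue measure on the
orthant `[0, ∞)^m` under `(t_1, …, t_m) ↦ ∑ t_j z_j`, where `Z = (z_1, …, z_m)`. -/
def splineMeasure (Z : List V) : Measure V :=
  ((volume : Measure (Fin Z.length → ℝ)).restrict {t | ∀ j, 0 ≤ t j}).map
    (fun t => ∑ j, t j • Z.get j)

/-- The defining formula `⟨T_Z | f⟩ = ∫_0^∞ ⋯ ∫_0^∞ f (∑ t_j z_j) dt_1 ⋯ dt_m`. -/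
theorem integral_splineMeasure [BorelSpace V] {𝕜 : Type*} [RCLike 𝕜] (Z : List V) {f : V → 𝕜}
    (hf : Continuous f) :
    ∫ x, f x ∂(splineMeasure Z)
      = ∫ t in {t : Fin Z.length → ℝ | ∀ j, 0 ≤ t j}, f (∑ j, t j • Z.get j) := by
  have hc : Continuous (fun t : Fin Z.length → ℝ => ∑ j, t j • Z.get j) := by fun_prop
  refine integral_map_of_stronglyMeasurable hc.measurable ?_
  exact hf.stronglyMeasurable

instance instSFiniteSplineMeasure (Z : List V) : SFinite (splineMeasure Z) := by
  unfold splineMeasure; infer_instance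

variable [BorelSpace V] [FiniteDimensional ℝ V]

/-- Lebesgue measure on the subspace `r` of `V`, normalized so that the lattice `Λ ∩ r` of `r` has
covolume `1`. -/
def latticeMeasure (Λ : Submodule ℤ V) (r : Submodule ℝ V) : Measure r :=
  (ENNReal.ofReal (ZLattice.covolume (ZLattice.comap ℝ Λ r.subtype)
    (Measure.addHaar : Measure r)))⁻¹ • Measure.addHaar

instance instSFiniteLatticeMeasure (Λ : Submodule ℤ V) (r : Submodule ℝ V) :
    SFinite (latticeMeasure Λ r) := by
  unfold latticeMeasure; infer_instance

variable {𝕜 : Type*} [RCLike 𝕜]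

/-- The value at `φ` of the distribution on `V` given by the polynomial density `g` on `r`:
`∫_r φ(y) g(y) dy`. -/
def densityPairing (Λ : Submodule ℤ V) (r : Submodule ℝ V) (g : r → 𝕜) (φ : 𝓢(V, 𝕜)) : 𝕜 :=
  ∫ y : r, φ (y : V) * g y ∂(latticeMeasure Λ r)

/-- The integrand `φ(x + y) g(y)`, `x ∈ V`, `y ∈ r`, of the convolution of a measure on `V` with the
density `g` on `r`. -/
def convIntegrand (r : Submodule ℝ V) (g : r → 𝕜) (φ : 𝓢(V, 𝕜)) : V × r → 𝕜 :=
  fun p => φ (p.1 + (p.2 : V)) * g p.2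

/-- Absolute convergence of the integral that defines `⟨T_Z^F * g | φ⟩`. -/
def ConvConverges (Λ : Submodule ℤ V) (Z : List V) (F : Set (StrongDual ℝ V))
    (r : Submodule ℝ V) (g : r → 𝕜) (φ : 𝓢(V, 𝕜)) : Prop :=
  Integrable (convIntegrand r g φ) ((splineMeasure (signedList Z F)).prod (latticeMeasure Λ r))

open Classical in
/-- The value at `φ` of the convolution `T_Z^F * g`, where `T_Z^F = (-1)^{|B|} T_{(A, -B)}` and `g`
is regarded as a density on `r`:
`⟨T_Z^F * g | φ⟩ = (-1)^{|B|} ∫_V ∫_r φ(x + y) g(y) dy dT_{(A, -B)}(x)`. -/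
def convPairing (Λ : Submodule ℤ V) (Z : List V) (F : Set (StrongDual ℝ V))
    (r : Submodule ℝ V) (g : r → 𝕜) (φ : 𝓢(V, 𝕜)) : 𝕜 :=
  (-1) ^ (Z.filter (fun a => ¬ ∀ u ∈ F, 0 < u a)).length *
    ∫ p, convIntegrand r g φ p ∂((splineMeasure (signedList Z F)).prod (latticeMeasure Λ r))

end Splines

end SplineSeq

end SplineSpaces

/-! Exactness on the left and in the middle is almost the definition: the conditions that cut
`𝒢(X)_{i+1}` out of `𝒢(X)` say that `∂_{X∖r} f = 0` for all rational `r` of dimension `i`. The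
content is that `μ_i` takes values in the polynomial spaces `D(X ∩ r)` and that `P_i` is a right
inverse.

Values of `μ_i` (`exists_polyD_isConv`): for `f ∈ 𝒢(X)_i`, `∂_{X∖r} f` comes from a distribution `h`
on `r`. If `H` is a rational hyperplane of `r`, then `X∖H` is the union of `(X∩r)∖H` and `X∖r`, so
`h` is killed by every cocircuit operator of `X∩r`. A prime ideal containing all cocircuit products
contains every `∂_a` (`mem_radical_of_cocircuits`), hence each `∂_a` acts nilpotently on `h`. A Weyl
algebra induction then shows that `h` is a polynomial (`exists_polynomial_density`). Its base case,
that a distribution with zero derivatives is constant, rests on the fact that a Schwartz function of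
integral zero is a sum of derivatives; on the Fourier side this is Hadamard's lemma at the origin.

Values of `P_i`: a functional `u ∈ F_r` vanishing on `r` is positive on the signed list, so on the
cone of the spline `‖x‖` is bounded by a multiple of `u x = u (x + y)`, for `y ∈ r`. This gives
absolute convergence and temperedness (`exists_convIntegrand_bound`). Differentiating along a vector
of the list removes it from the spline, and differentiating along `r` acts on `g`. So, with `T` the
convolution, if `r ≤ t` then `∂_{X∖t} T` is the convolution for `(X∖r) ∩ t`, which lives on `t` and
is `g` itself for `t = r` (`IsConv.listBetween`). If `r` is not contained in `t`, then `X∖t`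
contains a cocircuit of `X∩r` and `∂_{X∖t} T = 0` (`IsConv.distDerivList_eq_zero`). Distinct
subspaces of equal dimension are not nested, whence `μ_i P_i = Id`, and surjectivity follows. -/

noncomputable section SplineSpaces

namespace SplineSeq

/-! ### Schwartz functions with vanishing integral are divergences -/

section Poincare

open LineDeriv FourierTransform
open scoped ContDiff

/-- The weighted average `∫_0^1 τ ^ m φ(τ x) dτ` of a Schwartz function along rays. -/
def rayAverage {E F : Type*} [NormedAddCommGroup E] [NormedSpace ℝ E] [NormedAddCommGroup F]
    [NormedSpace ℝ F] (φ : 𝓢(E, F)) (m : ℕ) (x : E) : F :=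
  ∫ τ in (0 : ℝ)..1, τ ^ m • φ (τ • x)

theorem norm_rayAverage_le {E F : Type*} [NormedAddCommGroup E] [NormedSpace ℝ E]
    [NormedAddCommGroup F] [NormedSpace ℝ F] (φ : 𝓢(E, F)) (m : ℕ) (x : E) :
    ‖rayAverage φ m x‖ ≤ SchwartzMap.seminorm ℝ 0 0 φ := by
  have h := intervalIntegral.norm_integral_le_of_norm_le_const (a := (0 : ℝ)) (b := 1)
    (f := fun τ => τ ^ m • φ (τ • x)) (C := SchwartzMap.seminorm ℝ 0 0 φ) ?_
  · simpa [rayAverage] using h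
  · intro τ hτ
    rw [Set.uIoc_of_le zero_le_one] at hτ
    rw [norm_smul, norm_pow, Real.norm_of_nonneg hτ.1.le]
    exact (mul_le_of_le_one_left (norm_nonneg _) (pow_le_one₀ hτ.1.le hτ.2)).trans
      (norm_le_seminorm ℝ φ _)

/-- Differentiating `φ (τ • x)` in `x` brings out one more factor `τ`, which raises the weight by
one. -/
theorem hasFDerivAt_rayAverage {E F : Type*} [NormedAddCommGroup E] [NormedSpace ℝ E]
    [NormedAddCommGroup F] [NormedSpace ℝ F] (φ : 𝓢(E, F)) (m : ℕ) (x : E) :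
    HasFDerivAt (rayAverage φ m) (rayAverage (fderivCLM ℝ E F φ) (m + 1) x) x := by
  refine intervalIntegral.hasFDerivAt_integral_of_dominated_of_fderiv_le
    (F := fun x τ => τ ^ m • φ (τ • x))
    (F' := fun x τ => τ ^ (m + 1) • fderivCLM ℝ E F φ (τ • x))
    (bound := fun _ => SchwartzMap.seminorm ℝ 0 0 (fderivCLM ℝ E F φ)) Filter.univ_mem
    ?_ ?_ ?_ ?_ intervalIntegrable_const ?_
  · refine Filter.Eventually.of_forall fun y => Continuous.aestronglyMeasurable ?_
    exact (continuous_pow m).smul (φ.continuous.comp (by fun_prop))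
  · refine Continuous.intervalIntegrable ?_ _ _
    exact (continuous_pow m).smul (φ.continuous.comp (by fun_prop))
  · have := secondCountableTopologyEither_of_left ℝ (E →L[ℝ] F)
    refine Continuous.aestronglyMeasurable ?_
    exact (continuous_pow (m + 1)).smul
      ((fderivCLM ℝ E F φ).continuous.comp (by fun_prop))
  · refine Filter.Eventually.of_forall fun τ hτ y _ => ?_
    rw [Set.uIoc_of_le zero_le_one] at hτ
    rw [norm_smul, norm_pow, Real.norm_of_nonneg hτ.1.le]
    exact (mul_le_of_le_one_left (norm_nonneg _) (pow_le_one₀ hτ.1.le hτ.2)).trans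
      (norm_le_seminorm ℝ (fderivCLM ℝ E F φ) _)
  · refine Filter.Eventually.of_forall fun τ _ y _ => ?_
    have h1 : HasFDerivAt (fun y : E => τ • y) (τ • ContinuousLinearMap.id ℝ E) y :=
      (hasFDerivAt_id y).const_smul τ
    have h2 := ((φ.hasFDerivAt (τ • y)).comp y h1).const_smul (τ ^ m)
    refine h2.congr_fderiv ?_
    ext v
    simp [pow_succ, mul_smul]

/-- The induction replaces `φ` by its derivative, with values in `E →L[ℝ] F`; hence `F` and `m` are
quantified inside, and `E` and `F` share a universe. Ray averages need not decay, but bounded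
derivatives suffice for temperate growth. -/
theorem rayAverage_contDiff_bound {E : Type} [NormedAddCommGroup E] [NormedSpace ℝ E] (n : ℕ) :
    ∀ {F : Type} [NormedAddCommGroup F] [NormedSpace ℝ F] (φ : 𝓢(E, F)) (m : ℕ),
      ContDiff ℝ n (rayAverage φ m) ∧ ∃ C, ∀ x, ‖iteratedFDeriv ℝ n (rayAverage φ m) x‖ ≤ C := by
  induction n with
  | zero =>
    intro F _ _ φ m
    refine ⟨contDiff_zero.2 (continuous_iff_continuousAt.2 fun x =>
      (hasFDerivAt_rayAverage φ m x).continuousAt), SchwartzMap.seminorm ℝ 0 0 φ, fun x => ?_⟩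
    simpa using norm_rayAverage_le φ m x
  | succ n ih =>
    intro F _ _ φ m
    have hd : fderiv ℝ (rayAverage φ m) = rayAverage (fderivCLM ℝ E F φ) (m + 1) :=
      funext fun x => (hasFDerivAt_rayAverage φ m x).fderiv
    obtain ⟨h1, C, hC⟩ := ih (fderivCLM ℝ E F φ) (m + 1)
    constructor
    · rw [Nat.cast_add, Nat.cast_one, contDiff_succ_iff_fderiv]
      refine ⟨fun x => (hasFDerivAt_rayAverage φ m x).differentiableAt, by simp, ?_⟩
      rwa [hd]
    · refine ⟨C, fun x => ?_⟩
      rw [← norm_iteratedFDeriv_fderiv, hd]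
      exact hC x

theorem hasTemperateGrowth_rayAverage {E F : Type} [NormedAddCommGroup E] [NormedSpace ℝ E]
    [NormedAddCommGroup F] [NormedSpace ℝ F] (φ : 𝓢(E, F)) (m : ℕ) :
    (rayAverage φ m).HasTemperateGrowth := by
  refine ⟨contDiff_infty.2 fun n => (rayAverage_contDiff_bound n φ m).1, fun n => ?_⟩
  obtain ⟨C, hC⟩ := (rayAverage_contDiff_bound n φ m).2
  exact ⟨0, C, fun x => by simpa using hC x⟩

/-- Hadamard's lemma: the fundamental theorem of calculus along the segment from `0` to `x`. -/
theorem rayAverage_fderiv_apply_self {E F : Type*} [NormedAddCommGroup E] [NormedSpace ℝ E]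
    [NormedAddCommGroup F] [NormedSpace ℝ F] [CompleteSpace F] (φ : 𝓢(E, F)) (x : E) :
    rayAverage (fderivCLM ℝ E F φ) 0 x x = φ x - φ 0 := by
  have hc : Continuous fun τ : ℝ => fderivCLM ℝ E F φ (τ • x) :=
    (fderivCLM ℝ E F φ).continuous.comp (by fun_prop)
  have h1 : rayAverage (fderivCLM ℝ E F φ) 0 x x
      = ∫ τ in (0 : ℝ)..1, fderivCLM ℝ E F φ (τ • x) x := by
    rw [rayAverage]
    simp only [pow_zero, one_smul]
    exact ContinuousLinearMap.intervalIntegral_apply (hc.intervalIntegrable _ _) x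
  rw [h1, intervalIntegral.integral_eq_sub_of_hasDerivAt (f := fun τ : ℝ => φ (τ • x))]
  · simp
  · intro τ _
    have h2 : HasDerivAt (fun τ : ℝ => τ • x) x τ := by
      simpa using (hasDerivAt_id τ).smul_const x
    exact (φ.hasFDerivAt (τ • x)).comp_hasDerivAt τ h2
  · exact (hc.clm_apply continuous_const).intervalIntegrable _ _

variable {E : Type} [NormedAddCommGroup E] [InnerProductSpace ℝ E] [FiniteDimensional ℝ E]

/-- The Hadamard coefficients of `φ` in an orthonormal basis only have temperate growth; the factor
`ψ` makes them Schwartz functions. -/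
theorem smulLeft_sub_mem_span (φ ψ : 𝓢(E, ℂ)) :
    smulLeftCLM ℂ φ ψ - φ 0 • ψ ∈
      Submodule.span ℂ {f : 𝓢(E, ℂ) | ∃ (m : E) (Ψ : 𝓢(E, ℂ)),
        f = smulLeftCLM ℂ (fun x => inner ℝ x m) Ψ} := by
  have hT := hasTemperateGrowth_rayAverage (fderivCLM ℝ E ℂ φ) 0
  let b := stdOrthonormalBasis ℝ E
  have hg : ∀ i, (fun x => rayAverage (fderivCLM ℝ E ℂ φ) 0 x (b i)).HasTemperateGrowth := by
    intro i
    exact ((ContinuousLinearMap.apply ℝ ℂ (b i)).hasTemperateGrowth).comp hT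
  have key : smulLeftCLM ℂ φ ψ - φ 0 • ψ = ∑ i, smulLeftCLM ℂ (fun x => inner ℝ x (b i))
      (smulLeftCLM ℂ (fun x => rayAverage (fderivCLM ℝ E ℂ φ) 0 x (b i)) ψ) := by
    ext x
    have hi : ∀ m : E, (fun x : E => inner ℝ x m).HasTemperateGrowth := fun m => by fun_prop
    rw [sub_apply, smul_apply, smulLeftCLM_apply_apply φ.hasTemperateGrowth,
      sum_apply]
    simp only [smulLeftCLM_apply_apply (hi _), smulLeftCLM_apply_apply (hg _)]
    rw [← sub_smul, ← rayAverage_fderiv_apply_self]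
    have hx := congrArg (⇑(rayAverage (fderivCLM ℝ E ℂ φ) 0 x)) (b.sum_repr' x)
    rw [← hx, map_sum, Finset.sum_smul]
    simp [real_inner_comm, mul_assoc]
  rw [key]
  exact Submodule.sum_mem _ fun i _ => Submodule.subset_span ⟨_, _, rfl⟩

theorem mem_span_smulLeft_of_apply_zero {φ : 𝓢(E, ℂ)} (h0 : φ 0 = 0) :
    φ ∈ Submodule.span ℂ {f : 𝓢(E, ℂ) | ∃ (m : E) (Ψ : 𝓢(E, ℂ)),
        f = smulLeftCLM ℂ (fun x => inner ℝ x m) Ψ} := by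
  obtain ⟨ψ, hψ⟩ : ∃ ψ : 𝓢(E, ℂ), ψ 0 = 1 := by
    let f : ContDiffBump (0 : E) := ⟨1, 2, one_pos, one_lt_two⟩
    have hc : HasCompactSupport (fun x : E => ((f x : ℝ) : ℂ)) :=
      f.hasCompactSupport.comp_left Complex.ofReal_zero
    refine ⟨hc.toSchwartzMap (Complex.ofRealCLM.contDiff.comp f.contDiff), ?_⟩
    change ((f 0 : ℝ) : ℂ) = 1
    rw [f.one_of_mem_closedBall (Metric.mem_closedBall_self f.rIn_pos.le), Complex.ofReal_one]
  -- Both expansions contain the product of `φ` and `ψ`; their difference is `ψ 0 • φ - φ 0 • ψ =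
  -- φ`.
  have h1 := smulLeft_sub_mem_span φ ψ
  have h2 := smulLeft_sub_mem_span ψ φ
  have h3 : smulLeftCLM ℂ φ ψ = smulLeftCLM ℂ ψ φ := by
    ext x
    simp [smulLeftCLM_apply_apply, φ.hasTemperateGrowth, ψ.hasTemperateGrowth, mul_comm]
  have h4 := Submodule.sub_mem _ h1 h2
  rw [h0, hψ, h3] at h4
  simpa using h4

variable [MeasurableSpace E] [BorelSpace E]

/-- The integral is the value of the Fourier transform at `0`, and the inverse transform turns
multiplication by a linear form into a derivative, up to `2πi`. -/
theorem mem_span_lineDeriv_of_integral_eq_zero_complex {φ : 𝓢(E, ℂ)} (h0 : ∫ x, φ x = 0) :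
    φ ∈ Submodule.span ℂ {f : 𝓢(E, ℂ) | ∃ (m : E) (Ψ : 𝓢(E, ℂ)), f = ∂_{m} Ψ} := by
  have h1 : (𝓕 φ) 0 = 0 := by
    rw [fourier_coe, Real.fourier_eq]
    simpa using h0
  have h2 := mem_span_smulLeft_of_apply_zero h1
  have h3 := Submodule.mem_map_of_mem
    (f := (FourierTransform.fourierCLE ℂ 𝓢(E, ℂ)).symm.toLinearEquiv.toLinearMap) h2
  have h4 : (FourierTransform.fourierCLE ℂ 𝓢(E, ℂ)).symm (𝓕 φ) = φ :=
    (FourierTransform.fourierCLE ℂ 𝓢(E, ℂ)).symm_apply_apply φ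
  replace h3 := h4 ▸ h3
  refine (Submodule.map_span_le _ _ _).2 ?_ h3
  rintro _ ⟨m, Ψ, rfl⟩
  have hpi : (2 * (Real.pi : ℂ) * Complex.I) ≠ 0 := by
    simp [Real.pi_ne_zero]
  refine Submodule.subset_span ⟨m, (2 * (Real.pi : ℂ) * Complex.I)⁻¹ • 𝓕⁻ Ψ, ?_⟩
  rw [lineDerivOp_smul, lineDerivOp_fourierInv_eq, FourierTransform.fourierInv_smul, smul_smul,
    inv_mul_cancel₀ hpi, one_smul]
  rfl

theorem mem_span_lineDeriv_of_integral_eq_zero {𝕜 : Type*} [RCLike 𝕜] {W : Type*}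
    [NormedAddCommGroup W] [NormedSpace ℝ W] [FiniteDimensional ℝ W] [MeasurableSpace W]
    [BorelSpace W] (μ : Measure W) [μ.IsAddHaarMeasure] {φ : 𝓢(W, 𝕜)} (h0 : ∫ x, φ x ∂μ = 0) :
    φ ∈ Submodule.span 𝕜 {f : 𝓢(W, 𝕜) | ∃ (m : W) (Ψ : 𝓢(W, 𝕜)), f = ∂_{m} Ψ} := by
  let e : EuclideanSpace ℝ (Fin (Module.finrank ℝ W)) ≃L[ℝ] W :=
    ContinuousLinearEquiv.ofFinrankEq (by simp)
  let A : 𝓢(W, 𝕜) →L[ℝ] 𝓢(EuclideanSpace ℝ (Fin (Module.finrank ℝ W)), ℂ) :=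
    (compCLMOfContinuousLinearEquiv ℝ e).comp (postcompCLM (RCLike.map 𝕜 ℂ))
  let B : 𝓢(EuclideanSpace ℝ (Fin (Module.finrank ℝ W)), ℂ) →L[ℝ] 𝓢(W, 𝕜) :=
    (postcompCLM (RCLike.map ℂ 𝕜)).comp (compCLMOfContinuousLinearEquiv ℝ e.symm)
  have hBA : B (A φ) = φ := by
    ext x
    change RCLike.map ℂ 𝕜 (RCLike.map 𝕜 ℂ (φ (e (e.symm x)))) = φ x
    rw [e.apply_symm_apply]
    -- If `I = 0`, then `𝕜` is real: imaginary parts vanish and the passage through `ℂ` loses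
    -- nothing.
    rcases RCLike.I_mul_I_ax (K := 𝕜) with h | h
    · have h2 : RCLike.im (φ x) = 0 := by
        have := RCLike.mul_im_I_ax (φ x)
        rwa [h, map_zero, mul_zero, eq_comm] at this
      have h3 := RCLike.re_add_im (φ x)
      simp only [h2, h, mul_zero, add_zero, map_zero] at h3
      simp [RCLike.map_apply, h2, h3]
    · simp [RCLike.map_apply]
  have hA : ∫ x, A φ x = 0 := by
    have h1 : ∫ x, φ (e x) = 0 := by
      have h := e.toHomeomorph.measurableEmbedding.integral_map (μ := volume) φ
      change ∫ x, φ x ∂(Measure.map e volume) = ∫ x, φ (e x) at h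
      rw [← h, Measure.isAddLeftInvariant_eq_smul (Measure.map e volume) μ]
      erw [integral_smul_nnreal_measure]
      rw [h0, smul_zero]
    have h2 : ∫ x, A φ x = RCLike.map 𝕜 ℂ (∫ x, φ (e x)) := by
      exact ContinuousLinearMap.integral_comp_comm (RCLike.map 𝕜 ℂ)
        (φ := fun x => φ (e x)) <|
        (compCLMOfContinuousLinearEquiv ℝ e φ).integrable
    rw [h2, h1, map_zero]
  have hB (f : 𝓢(EuclideanSpace ℝ (Fin (Module.finrank ℝ W)), ℂ))
      (hf : f ∈ Submodule.span ℂ {f : 𝓢(EuclideanSpace ℝ (Fin (Module.finrank ℝ W)), ℂ) |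
        ∃ (m : EuclideanSpace ℝ (Fin (Module.finrank ℝ W)))
          (Ψ : 𝓢(EuclideanSpace ℝ (Fin (Module.finrank ℝ W)), ℂ)), f = ∂_{m} Ψ}) :
      B f ∈ Submodule.span 𝕜 {f : 𝓢(W, 𝕜) | ∃ (m : W) (Ψ : 𝓢(W, 𝕜)), f = ∂_{m} Ψ} := by
    induction hf using Submodule.closure_induction with
    | zero => rw [map_zero]; exact Submodule.zero_mem _
    | add x y _ _ hx hy => rw [map_add]; exact Submodule.add_mem _ hx hy
    | smul_mem c x hx =>
      obtain ⟨m, Ψ, rfl⟩ := hx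
      -- `B` is only real linear, so the complex scalar `c` is absorbed into `Ψ` before `B` is
      -- applied.
      refine Submodule.subset_span ⟨e m, B (c • Ψ), ?_⟩
      rw [← lineDerivOp_smul]
      ext x
      simp only [B, lineDerivOp_apply_eq_fderiv, ContinuousLinearMap.comp_apply]
      change RCLike.map ℂ 𝕜 (fderiv ℝ (c • Ψ) (e.symm x) m)
        = fderiv ℝ (RCLike.map ℂ 𝕜 ∘ ((c • Ψ) ∘ e.symm)) x (e m)
      rw [((RCLike.map ℂ 𝕜).hasFDerivAt.comp x
        (((c • Ψ).hasFDerivAt (e.symm x)).comp x e.symm.hasFDerivAt)).fderiv]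
      simp
  rw [← hBA]
  exact hB _ (mem_span_lineDeriv_of_integral_eq_zero_complex hA)

end Poincare

/-! ### Derivatives of distributions and multiplication by linear forms -/

section DistributionAlgebra

open LineDeriv

variable {𝕜 : Type*} [RCLike 𝕜] {V : Type*} [NormedAddCommGroup V] [NormedSpace ℝ V]

@[simp]
theorem distDeriv_apply (a : V) (f : TempDist 𝕜 V) (φ : 𝓢(V, 𝕜)) :
    distDeriv 𝕜 a f φ = -f (∂_{a} φ) := by
  change f (-∂_{a} φ) = _
  rw [map_neg]

theorem lineDerivOp_comm (a b : V) (φ : 𝓢(V, 𝕜)) : ∂_{a} (∂_{b} φ) = ∂_{b} (∂_{a} φ) := by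
  have key : ∀ (a b x : V), (∂_{a} (∂_{b} φ)) x = fderiv ℝ (fderiv ℝ φ) x a b := by
    intro a b x
    rw [lineDerivOp_apply_eq_fderiv]
    have h1 : (⇑(∂_{b} φ : 𝓢(V, 𝕜)) : V → 𝕜) = fun x => fderiv ℝ φ x b := rfl
    have h2 : DifferentiableAt ℝ (fderiv ℝ φ) x := (fderivCLM ℝ V 𝕜 φ).differentiableAt
    rw [h1, fderiv_clm_apply h2 (differentiableAt_const b)]
    simp
  ext x
  rw [key, key]
  exact ((φ.contDiffAt 2).isSymmSndFDerivAt (by simp)) a b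

theorem distDeriv_commute (a b : V) : Commute (distDeriv 𝕜 a) (distDeriv 𝕜 b) := by
  ext f φ
  simp [lineDerivOp_comm a b]

theorem distDeriv_add (a b : V) : distDeriv 𝕜 (a + b) = distDeriv 𝕜 a + distDeriv 𝕜 b := by
  ext f φ
  simp [lineDerivOp_left_add, add_comm]

theorem distDeriv_smul (c : ℝ) (a : V) : distDeriv 𝕜 (c • a) = (c : 𝕜) • distDeriv 𝕜 a := by
  ext f φ
  have h : (∂_{c • a} φ : 𝓢(V, 𝕜)) = (c : 𝕜) • (∂_{a} φ : 𝓢(V, 𝕜)) := by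
    ext x
    simp [lineDerivOp_apply_eq_fderiv, RCLike.real_smul_eq_coe_mul]
  change distDeriv 𝕜 (c • a) f φ = (c : 𝕜) • distDeriv 𝕜 a f φ
  rw [distDeriv_apply, distDeriv_apply, h, map_smul, smul_neg]

theorem distDeriv_zero : distDeriv 𝕜 (0 : V) = 0 := by
  ext f φ
  simp

theorem distDerivList_nil : distDerivList 𝕜 ([] : List V) = 1 := rfl

theorem distDerivList_cons (a : V) (Y : List V) :
    distDerivList 𝕜 (a :: Y) = distDeriv 𝕜 a * distDerivList 𝕜 Y := by
  simp [distDerivList]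

theorem distDerivList_append (Y Z : List V) :
    distDerivList 𝕜 (Y ++ Z) = distDerivList 𝕜 Y * distDerivList 𝕜 Z := by
  simp [distDerivList]

theorem distDerivList_perm {Y Z : List V} (h : Y.Perm Z) :
    distDerivList 𝕜 Y = distDerivList 𝕜 Z := by
  refine (h.map _).prod_eq' (List.pairwise_of_forall_mem_list ?_)
  intro S hS T hT
  obtain ⟨a, -, rfl⟩ := List.mem_map.1 hS
  obtain ⟨b, -, rfl⟩ := List.mem_map.1 hT
  exact distDeriv_commute a b

/-- Multiplication of a distribution by a real linear form. -/
def distMul (l : V →L[ℝ] ℝ) : TempDist 𝕜 V →ₗ[𝕜] TempDist 𝕜 V :=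
  (PointwiseConvergenceCLM.precomp 𝕜
    (smulLeftCLM 𝕜 (fun x => ((l x : ℝ) : 𝕜))) : TempDist 𝕜 V →L[𝕜] TempDist 𝕜 V)

theorem hasTemperateGrowth_linear (l : V →L[ℝ] ℝ) :
    (fun x => ((l x : ℝ) : 𝕜)).HasTemperateGrowth :=
  ((RCLike.ofRealCLM (K := 𝕜)).comp l).hasTemperateGrowth

@[simp]
theorem distMul_apply (l : V →L[ℝ] ℝ) (f : TempDist 𝕜 V) (φ : 𝓢(V, 𝕜)) :
    distMul l f φ = f (smulLeftCLM 𝕜 (fun x => ((l x : ℝ) : 𝕜)) φ) := rfl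

theorem lineDerivOp_smulLeft_linear (l : V →L[ℝ] ℝ) (a : V) (φ : 𝓢(V, 𝕜)) :
    ∂_{a} (smulLeftCLM 𝕜 (fun x => ((l x : ℝ) : 𝕜)) φ)
      = ((l a : ℝ) : 𝕜) • φ + smulLeftCLM 𝕜 (fun x => ((l x : ℝ) : 𝕜)) (∂_{a} φ) := by
  ext x
  have h1 : HasFDerivAt (fun x => ((l x : ℝ) : 𝕜)) ((RCLike.ofRealCLM (K := 𝕜)).comp l) x :=
    ((RCLike.ofRealCLM (K := 𝕜)).comp l).hasFDerivAt
  have h2 := (h1.mul (φ.hasFDerivAt x)).fderiv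
  have h3 : (⇑(smulLeftCLM 𝕜 (fun x => ((l x : ℝ) : 𝕜)) φ) : V → 𝕜)
      = fun x => ((l x : ℝ) : 𝕜) * φ x := by
    ext y; rw [smulLeftCLM_apply_apply (hasTemperateGrowth_linear l), smul_eq_mul]
  rw [lineDerivOp_apply_eq_fderiv, h3]
  refine (congrArg (fun L => L a) h2).trans ?_
  change _ = ((l a : ℝ) : 𝕜) * φ x
    + (smulLeftCLM 𝕜 (fun x => ((l x : ℝ) : 𝕜)) (∂_{a} φ : 𝓢(V, 𝕜))) x
  rw [smulLeftCLM_apply_apply (hasTemperateGrowth_linear l)]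
  simp [lineDerivOp_apply_eq_fderiv]
  ring

theorem distDeriv_mul_distMul (l : V →L[ℝ] ℝ) (a : V) :
    distDeriv 𝕜 a * distMul l = distMul l * distDeriv 𝕜 a + ((l a : ℝ) : 𝕜) • 1 := by
  ext f φ
  have h := congrArg f (lineDerivOp_smulLeft_linear l a φ)
  simp only [Module.End.mul_apply, LinearMap.add_apply, LinearMap.smul_apply, Module.End.one_apply]
  change distDeriv 𝕜 a (distMul l f) φ = distMul l (distDeriv 𝕜 a f) φ + ((l a : ℝ) : 𝕜) • f φ
  rw [distDeriv_apply, distMul_apply, distMul_apply, distDeriv_apply, h, map_add, map_smul]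
  simp

end DistributionAlgebra

/-- In a Weyl algebra relation `D M = M D + 1`, `D ^ n M ^ n` acts on `ker D` as `n!`. -/
theorem weyl_pow_apply {𝕜 E : Type*} [Field 𝕜] [AddCommGroup E] [Module 𝕜 E]
    {D M : Module.End 𝕜 E} (h : D * M = M * D + 1) {c : E} (hc : D c = 0) (n : ℕ) :
    (D ^ n) ((M ^ n) c) = (n.factorial : 𝕜) • c := by
  have h1 : ∀ n : ℕ, D ((M ^ (n + 1)) c) = ((n : 𝕜) + 1) • (M ^ n) c := by
    intro n
    induction n with
    | zero =>
      have := LinearMap.congr_fun h c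
      simpa [hc] using this
    | succ n ih =>
      have := LinearMap.congr_fun h ((M ^ (n + 1)) c)
      rw [pow_succ' M (n + 1)]
      simp only [Module.End.mul_apply, LinearMap.add_apply, Module.End.one_apply] at this ⊢
      rw [this, ih, map_smul, ← Module.End.mul_apply, ← pow_succ']
      push_cast
      module
  induction n with
  | zero => simp
  | succ n ih =>
    rw [pow_succ D, Module.End.mul_apply, h1, map_smul, ih, Nat.factorial_succ, smul_smul]
    push_cast
    rfl

/-! ### Polynomial distributions -/

section PolynomialDistributions

open LineDeriv

variable {𝕜 : Type*} [RCLike 𝕜] {W : Type*} [NormedAddCommGroup W] [NormedSpace ℝ W]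

theorem hasTemperateGrowth_of_mem_polyFun {g : W → 𝕜} (hg : g ∈ polyFun 𝕜 W) :
    g.HasTemperateGrowth := by
  induction hg using Algebra.adjoin_induction with
  | mem f hf => obtain ⟨l, rfl⟩ := hf; exact hasTemperateGrowth_linear l
  | algebraMap c => exact Function.HasTemperateGrowth.const c
  | add f g _ _ hf hg => exact hf.add hg
  | mul f g _ _ hf hg => exact hf.mul hg

variable [MeasurableSpace W]

/-- `h` is the distribution given by the density `g` with respect to `μ`. -/
def HasDensity (μ : Measure W) (h : TempDist 𝕜 W) (g : W → 𝕜) : Prop :=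
  ∀ φ : 𝓢(W, 𝕜), h φ = ∫ x, φ x * g x ∂μ

theorem HasDensity.smul {μ : Measure W} {h : TempDist 𝕜 W} {g : W → 𝕜} (H : HasDensity μ h g) (c : 𝕜) :
    HasDensity μ (c • h) (c • g) := by
  intro φ
  change c • h φ = _
  rw [H, smul_eq_mul, ← integral_const_mul]
  simp [mul_left_comm]

theorem HasDensity.distMul {μ : Measure W} {h : TempDist 𝕜 W} {g : W → 𝕜} (H : HasDensity μ h g)
    (l : W →L[ℝ] ℝ) :
    HasDensity μ (distMul l h) ((fun x => ((l x : ℝ) : 𝕜)) * g) := by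
  intro φ
  rw [distMul_apply, H]
  refine integral_congr_ae (Filter.Eventually.of_forall fun x => ?_)
  simp only [smulLeftCLM_apply_apply (hasTemperateGrowth_linear (𝕜 := 𝕜) l), smul_eq_mul,
    Pi.mul_apply]
  ring

variable [BorelSpace W] [FiniteDimensional ℝ W] {μ : Measure W} [μ.IsAddHaarMeasure]

theorem integrable_schwartz_mul {g : W → 𝕜} (hg : g.HasTemperateGrowth) (φ : 𝓢(W, 𝕜)) :
    Integrable (fun x => φ x * g x) μ := by
  have h := (smulLeftCLM 𝕜 g φ).integrable (μ := μ)
  refine h.congr (Filter.Eventually.of_forall fun x => ?_)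
  simp [smulLeftCLM_apply_apply hg, mul_comm]

theorem HasDensity.add {h₁ h₂ : TempDist 𝕜 W} {g₁ g₂ : W → 𝕜} (H₁ : HasDensity μ h₁ g₁)
    (H₂ : HasDensity μ h₂ g₂) (hg₁ : g₁.HasTemperateGrowth) (hg₂ : g₂.HasTemperateGrowth) :
    HasDensity μ (h₁ + h₂) (g₁ + g₂) := by
  intro φ
  change h₁ φ + h₂ φ = _
  rw [H₁, H₂, ← integral_add (integrable_schwartz_mul hg₁ φ) (integrable_schwartz_mul hg₂ φ)]
  simp [mul_add]

variable (μ) in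
theorem exists_schwartz_integral_eq_one : ∃ χ : 𝓢(W, 𝕜), ∫ x, χ x ∂μ = 1 := by
  let e : W ≃L[ℝ] EuclideanSpace ℝ (Fin (Module.finrank ℝ W)) :=
    ContinuousLinearEquiv.ofFinrankEq (by simp)
  let f : ContDiffBump (0 : W) := ⟨1, 2, one_pos, one_lt_two⟩
  have hc : HasCompactSupport (fun x : W => ((f.normed μ x : ℝ) : 𝕜)) :=
    f.hasCompactSupport_normed.comp_left RCLike.ofReal_zero
  refine ⟨hc.toSchwartzMap ((RCLike.ofRealCLM (K := 𝕜)).contDiff.comp f.contDiff_normed), ?_⟩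
  change ∫ x, ((f.normed μ x : ℝ) : 𝕜) ∂μ = 1
  rw [integral_ofReal, f.integral_normed, RCLike.ofReal_one]

variable (μ) in
-- For `χ` of integral one, `φ - (∫ φ) χ` has integral zero, so it is a sum of derivatives and `h`
-- kills it; the constant is `h χ`.
theorem exists_hasDensity_const {h : TempDist 𝕜 W} (hh : ∀ a, distDeriv 𝕜 a h = 0) :
    ∃ c : 𝕜, HasDensity μ h (algebraMap 𝕜 (W → 𝕜) c) := by
  obtain ⟨χ, hχ⟩ := exists_schwartz_integral_eq_one (𝕜 := 𝕜) μ
  refine ⟨h χ, fun φ => ?_⟩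
  have h0 : ∫ x, (φ - (∫ y, φ y ∂μ) • χ) x ∂μ = 0 := by
    have h1 : ∀ x, (φ - (∫ y, φ y ∂μ) • χ) x = φ x - (∫ y, φ y ∂μ) * χ x := fun x => rfl
    simp_rw [h1]
    rw [integral_sub φ.integrable (χ.integrable.const_mul _), integral_const_mul, hχ, mul_one,
      sub_self]
  have hker : Submodule.span 𝕜 {f : 𝓢(W, 𝕜) | ∃ (m : W) (Ψ : 𝓢(W, 𝕜)), f = ∂_{m} Ψ}
      ≤ LinearMap.ker (h : 𝓢(W, 𝕜) →ₗ[𝕜] 𝕜) := by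
    rw [Submodule.span_le]
    rintro _ ⟨m, Ψ, rfl⟩
    have h2 : distDeriv 𝕜 m h Ψ = 0 := by rw [hh m]; rfl
    rw [distDeriv_apply, neg_eq_zero] at h2
    exact h2
  have h3 : h (φ - (∫ y, φ y ∂μ) • χ) = 0 :=
    hker (mem_span_lineDeriv_of_integral_eq_zero μ h0)
  rw [map_sub, map_smul, sub_eq_zero] at h3
  rw [h3, smul_eq_mul, ← integral_mul_const]
  rfl

/-- Induction on the total order `∑ N i`. The exponent is `N i + 1`, so total order zero means that
all first derivatives vanish. -/
theorem exists_density_of_pow_basis {ι : Type*} [Fintype ι] (b : Module.Basis ι ℝ W) (k : ℕ) :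
    ∀ (N : ι → ℕ) (h : TempDist 𝕜 W), ∑ i, N i ≤ k →
      (∀ i, (distDeriv 𝕜 (b i) ^ (N i + 1)) h = 0) →
      ∃ g ∈ polyFun 𝕜 W, HasDensity μ h g := by
  classical
  induction k with
  | zero =>
    intro N h hN hh
    have hN0 : ∀ i, N i = 0 := by simpa using hN
    have h1 : ∀ a, distDeriv 𝕜 a h = 0 := by
      intro a
      have : ∀ a ∈ Submodule.span ℝ (Set.range b), distDeriv 𝕜 a h = 0 := by
        intro a ha
        induction ha using Submodule.span_induction with
        | mem x hx => obtain ⟨i, rfl⟩ := hx; simpa [hN0 i] using hh i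
        | zero => rw [distDeriv_zero]; rfl
        | add x y _ _ hx hy => rw [distDeriv_add, LinearMap.add_apply, hx, hy, add_zero]
        | smul c x _ hx => rw [distDeriv_smul, LinearMap.smul_apply, hx, smul_zero]
      exact this a (by rw [b.span_eq]; trivial)
    obtain ⟨c, hc⟩ := exists_hasDensity_const μ h1
    exact ⟨_, Subalgebra.algebraMap_mem _ c, hc⟩
  | succ k ih =>
    intro N h hN hh
    by_cases h0 : ∀ i, N i = 0
    · exact ih N h (by simp [h0]) hh
    push Not at h0
    obtain ⟨i, hi⟩ := h0
    obtain ⟨m, hm⟩ := Nat.exists_eq_succ_of_ne_zero hi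
    let l : W →L[ℝ] ℝ := LinearMap.toContinuousLinearMap (b.coord i)
    let D : Module.End 𝕜 (TempDist 𝕜 W) := distDeriv 𝕜 (b i)
    let M : Module.End 𝕜 (TempDist 𝕜 W) := distMul l
    have hl : ∀ j, l (b j) = if j = i then 1 else 0 := by
      intro j
      simp [l, Module.Basis.coord_apply, Finsupp.single_apply]
    have hDM : D * M = M * D + 1 := by
      have := distDeriv_mul_distMul (𝕜 := 𝕜) l (b i)
      simpa [hl] using this
    have hcomm : ∀ j, j ≠ i → Commute (distDeriv 𝕜 (b j)) M := by
      intro j hj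
      have := distDeriv_mul_distMul (𝕜 := 𝕜) l (b j)
      simpa [hl, hj, Commute, SemiconjBy] using this
    -- `c` is the top coefficient of `h` in the `i`-th coordinate. Since `D ^ (m + 1)` maps `M ^ (m
    -- + 1) c` to `(m + 1)! c`, subtracting `M ^ (m + 1) c / (m + 1)!` from `h` lowers the order in
    -- this coordinate. Induction applies to the difference and to `c`.
    set c := (D ^ (m + 1)) h with hc
    have hDc : D c = 0 := by
      have := hh i
      rw [hm, pow_succ' , Module.End.mul_apply] at this
      exact this
    have hsum : ∀ n : ℕ, n ≤ m → ∑ j, Function.update N i n j ≤ k := by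
      intro n hn
      have h1 := Finset.sum_update_of_mem (Finset.mem_univ i) N n
      have h2 := Finset.add_sum_erase Finset.univ N (Finset.mem_univ i)
      rw [← Finset.erase_eq] at h1
      omega
    have hDjc : ∀ j, j ≠ i → (distDeriv 𝕜 (b j) ^ (N j + 1)) c = 0 := by
      intro j hj
      rw [hc, ← Module.End.mul_apply, ((distDeriv_commute (b j) (b i)).pow_pow _ _).eq,
        Module.End.mul_apply, hh j, map_zero]
    obtain ⟨gc, hgc, Hc⟩ := ih (Function.update N i 0) c (hsum 0 (Nat.zero_le _)) (by
      intro j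
      by_cases hj : j = i
      · subst hj; simpa using hDc
      · rw [Function.update_of_ne hj, hDjc j hj])
    have hMpoly : ∀ n : ℕ, ∃ g ∈ polyFun 𝕜 W, HasDensity μ ((M ^ n) c) g := by
      intro n
      induction n with
      | zero => exact ⟨gc, hgc, Hc⟩
      | succ n ihn =>
        obtain ⟨g, hg, Hg⟩ := ihn
        refine ⟨_, Subalgebra.mul_mem _ (Algebra.subset_adjoin ⟨l, rfl⟩) hg, ?_⟩
        rw [pow_succ', Module.End.mul_apply]
        exact Hg.distMul l
    obtain ⟨g₁, hg₁, H₁⟩ := hMpoly (m + 1)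
    have hfac : ((m + 1).factorial : 𝕜) ≠ 0 := Nat.cast_ne_zero.2 (Nat.factorial_ne_zero _)
    obtain ⟨g₂, hg₂, H₂⟩ := ih (Function.update N i m)
        (h + (-((m + 1).factorial : 𝕜)⁻¹) • (M ^ (m + 1)) c) (hsum m le_rfl) (by
      intro j
      by_cases hj : j = i
      · subst hj
        rw [Function.update_self, map_add, map_smul, weyl_pow_apply hDM hDc, smul_smul,
          neg_mul, inv_mul_cancel₀ hfac, neg_one_smul, ← hc, add_neg_cancel]
      · rw [Function.update_of_ne hj, map_add, hh j, map_smul, ← Module.End.mul_apply,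
          ((hcomm j hj).pow_pow _ _).eq, Module.End.mul_apply, hDjc j hj, map_zero, zero_add]
        have h0 : ∀ s : 𝕜, s • (0 : TempDist 𝕜 W) = 0 := fun s =>
          smul_zero (A := TempDist 𝕜 W) s
        exact h0 _)
    refine ⟨g₂ + ((m + 1).factorial : 𝕜)⁻¹ • g₁,
      Subalgebra.add_mem _ hg₂ (Subalgebra.smul_mem _ hg₁ _), ?_⟩
    have H := H₂.add (H₁.smul (((m + 1).factorial : 𝕜)⁻¹))
      (hasTemperateGrowth_of_mem_polyFun hg₂)
      (hasTemperateGrowth_of_mem_polyFun (Subalgebra.smul_mem _ hg₁ _))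
    convert H using 1
    module

variable (μ) in
/-- A tempered distribution on which all directional derivatives act nilpotently is a
polynomial. -/
theorem exists_polynomial_density {h : TempDist 𝕜 W}
    (hh : ∀ a, ∃ N : ℕ, (distDeriv 𝕜 a ^ N) h = 0) :
    ∃ g ∈ polyFun 𝕜 W, HasDensity μ h g := by
  choose N hN using hh
  let b := Module.finBasis ℝ W
  refine exists_density_of_pow_basis b _ (fun i => N (b i)) h le_rfl fun i => ?_
  rw [pow_succ', Module.End.mul_apply, hN, map_zero]

end PolynomialDistributions

/-! ### Rational subspaces -/

section Rational

variable {V : Type*} [AddCommGroup V] [Module ℝ V]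

theorem mem_listDiff {X : List V} {r : Submodule ℝ V} {a : V} :
    a ∈ listDiff X r ↔ a ∈ X ∧ a ∉ r := by
  simp [listDiff]

theorem IsRational.of_le_span {X : List V} {r : Submodule ℝ V} {S : Set V}
    (hS : ∀ a ∈ S, a ∈ X) (h : r = Submodule.span ℝ S) : IsRational X r := by
  refine le_antisymm ?_ (Submodule.span_le.2 fun a ha => ha.2)
  conv_lhs => rw [h]
  refine Submodule.span_mono fun a ha => ⟨hS a ha, ?_⟩
  rw [h]
  exact Submodule.subset_span ha

variable [FiniteDimensional ℝ V]

theorem IsRational.exists_step {X : List V} (hX : Submodule.span ℝ {a | a ∈ X} = ⊤)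
    {r : Submodule ℝ V} (hr : IsRational X r) (hne : r ≠ ⊤) :
    ∃ r', IsRational X r' ∧ r ≤ r' ∧ Module.finrank ℝ r' = Module.finrank ℝ r + 1 := by
  obtain ⟨a, haX, har⟩ : ∃ a ∈ X, a ∉ r := by
    by_contra! h
    exact hne (top_le_iff.1 (hX ▸ Submodule.span_le.2 h))
  refine ⟨r ⊔ Submodule.span ℝ {a}, ?_, le_sup_left, Submodule.finrank_sup_span_singleton har⟩
  refine IsRational.of_le_span (S := {b | b ∈ X ∧ b ∈ r} ∪ {a}) ?_ ?_
  · rintro b (hb | rfl)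
    exacts [hb.1, haX]
  · rw [Submodule.span_union, ← hr]

theorem IsRational.exists_hyperplane {X : List V} (hX : Submodule.span ℝ {a | a ∈ X} = ⊤)
    {r : Submodule ℝ V} (hr : IsRational X r) (hne : r ≠ ⊤) :
    ∃ H, IsRational X H ∧ r ≤ H ∧ Module.finrank ℝ H + 1 = Module.finrank ℝ V := by
  obtain ⟨n, hn⟩ : ∃ n, Module.finrank ℝ r + n + 1 = Module.finrank ℝ V :=
    ⟨Module.finrank ℝ V - Module.finrank ℝ r - 1, by
      have := Submodule.finrank_lt hne
      omega⟩
  induction n generalizing r with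
  | zero => exact ⟨r, hr, le_rfl, hn⟩
  | succ n ih =>
    obtain ⟨r', hr', hle, hfin⟩ := hr.exists_step hX hne
    have hne' : r' ≠ ⊤ := by
      rintro rfl
      rw [finrank_top] at hfin
      omega
    obtain ⟨H, hH, hle', hfin'⟩ := ih hr' hne' (by omega)
    exact ⟨H, hH, hle.trans hle', hfin'⟩

/-- If the products over the cocircuits of a spanning list `Z` lie in an ideal `I`, all vectors are
nilpotent modulo `I`. -/
theorem mem_radical_of_cocircuits {A : Type*} [CommRing A] (D : V → A)
    (hadd : ∀ a b, D (a + b) = D a + D b) (hsmul : ∀ (c : ℝ) a, ∃ u, D (c • a) = u * D a)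
    {Z : List V} (hZ : Submodule.span ℝ {a | a ∈ Z} = ⊤) (I : Ideal A)
    (hI : ∀ Y, IsCocircuit Z Y → (Y.map D).prod ∈ I) (a : V) : D a ∈ I.radical := by
  rw [Ideal.radical_eq_sInf, Submodule.mem_sInf]
  rintro P ⟨hIP, hP⟩
  have hD0 : D 0 = 0 := by simpa using hadd 0 0
  let Q : Submodule ℝ V :=
    { carrier := {a | D a ∈ P}
      add_mem' := fun {a b} ha hb => by
        change D (a + b) ∈ P
        rw [hadd]; exact P.add_mem ha hb
      zero_mem' := by
        change D 0 ∈ P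
        rw [hD0]; exact P.zero_mem
      smul_mem' := fun c a ha => by
        obtain ⟨u, hu⟩ := hsmul c a
        change D (c • a) ∈ P
        rw [hu]; exact Ideal.mul_mem_left P u ha }
  -- If `t` is proper, it lies in a rational hyperplane `H`. The prime `P` contains the cocircuit
  -- product of `H`, hence a factor `D z` with `z ∉ H`; but then `z ∈ Z ∩ Q` lies in `t ≤ H`.
  let t := Submodule.span ℝ {z | z ∈ Z ∧ z ∈ Q}
  have htQ : t ≤ Q := Submodule.span_le.2 fun z hz => hz.2
  have ht : IsRational Z t := IsRational.of_le_span (fun z hz => hz.1) rfl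
  by_cases htop : t = ⊤
  · exact htQ (htop ▸ Submodule.mem_top : a ∈ t)
  obtain ⟨H, hH, htH, hfin⟩ := ht.exists_hyperplane hZ htop
  have hprod := hIP (hI _ ⟨H, hH, hfin, rfl⟩)
  obtain ⟨z, hz, hzP⟩ : ∃ z ∈ listDiff Z H, D z ∈ P := by
    rw [← Multiset.prod_coe, hP.multiset_prod_mem_iff_exists_mem] at hprod
    obtain ⟨x, hx, hxP⟩ := hprod
    obtain ⟨z, hz, rfl⟩ := List.mem_map.1 (Multiset.mem_coe.1 hx)
    exact ⟨z, hz, hxP⟩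
  obtain ⟨hzZ, hzH⟩ := mem_listDiff.1 hz
  exact absurd (htH (Submodule.subset_span ⟨hzZ, hzP⟩)) hzH

end Rational

section Nilpotent

variable {𝕜 : Type*} [RCLike 𝕜] {W : Type*} [NormedAddCommGroup W] [NormedSpace ℝ W]
  [FiniteDimensional ℝ W]

-- The radical argument is applied in the commutative algebra generated by the directional
-- derivatives, to the ideal of operators that annihilate `h`.
open scoped IsMulCommutative in
theorem exists_pow_distDeriv_eq_zero {Z : List W} (hZ : Submodule.span ℝ {a | a ∈ Z} = ⊤)
    {h : TempDist 𝕜 W} (hh : ∀ Y, IsCocircuit Z Y → distDerivList 𝕜 Y h = 0) (a : W) :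
    ∃ N : ℕ, (distDeriv 𝕜 a ^ N) h = 0 := by
  let A := Algebra.adjoin 𝕜 (Set.range (distDeriv 𝕜 : W → Module.End 𝕜 (TempDist 𝕜 W)))
  have hcomm : IsMulCommutative A := Algebra.isMulCommutative_adjoin 𝕜 (by
    rintro _ ⟨a, rfl⟩ _ ⟨b, rfl⟩
    exact distDeriv_commute a b)
  let D : W → A := fun a => ⟨distDeriv 𝕜 a, Algebra.subset_adjoin ⟨a, rfl⟩⟩
  let I : Ideal A :=
    { carrier := {T | T.1 h = 0}
      add_mem' := fun {S T} hS hT => by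
        change (S.1 + T.1) h = 0
        rw [LinearMap.add_apply, hS, hT, add_zero]
      zero_mem' := rfl
      smul_mem' := fun S T hT => by
        change (S.1 * T.1) h = 0
        rw [Module.End.mul_apply, hT, map_zero] }
  have hrad := mem_radical_of_cocircuits D
    (fun a b => Subtype.ext (distDeriv_add a b))
    (fun c a => ⟨algebraMap 𝕜 A (c : 𝕜), Subtype.ext (by
      change distDeriv 𝕜 (c • a) = algebraMap 𝕜 (Module.End 𝕜 (TempDist 𝕜 W)) (c : 𝕜) * distDeriv 𝕜 a
      rw [distDeriv_smul, ← Algebra.smul_def])⟩) hZ I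
    (fun Y hY => by
      have h1 : ((Y.map D).prod : A).1 = distDerivList 𝕜 Y := by
        change A.val _ = _
        rw [map_list_prod, List.map_map]
        rfl
      change ((Y.map D).prod : A).1 h = 0
      rw [h1]
      exact hh Y hY) a
  obtain ⟨N, hN⟩ := hrad
  exact ⟨N, hN⟩

end Nilpotent

/-! ### Extension of Schwartz functions from subspaces -/

section Extension

open LineDeriv
open scoped ContDiff

variable {𝕜 : Type*} [RCLike 𝕜] {V : Type*} [NormedAddCommGroup V] [NormedSpace ℝ V]

theorem norm_iteratedFDeriv_comp_clm_le {E F G : Type*} [NormedAddCommGroup E] [NormedSpace ℝ E]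
    [NormedAddCommGroup F] [NormedSpace ℝ F] [NormedAddCommGroup G] [NormedSpace ℝ G]
    (L : E →L[ℝ] F) {f : F → G} (hf : ContDiff ℝ ∞ f) (x : E) (i : ℕ) :
    ‖iteratedFDeriv ℝ i (f ∘ L) x‖ ≤ ‖iteratedFDeriv ℝ i f (L x)‖ * ‖L‖ ^ i := by
  rw [L.iteratedFDeriv_comp_right hf x (i := i) (mod_cast le_top)]
  refine (ContinuousMultilinearMap.norm_compContinuousLinearMap_le _ _).trans ?_
  simp

/-- Gives continuity of the extension `φ ↦ χ(q x) φ(π x)`. As `‖x‖ ≤ ‖q x‖ + ‖π x‖`, the weight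
splits between the two factors, and Leibniz' rule does the rest. -/
theorem exists_extension_bound {r : Submodule ℝ V} (π : V →L[ℝ] r) (q : V →L[ℝ] V)
    (hq : ∀ x, (π x : V) + q x = x) (χ : 𝓢(V, ℝ)) (k n : ℕ) :
    ∃ C : ℝ, 0 ≤ C ∧ ∀ (φ : 𝓢(r, 𝕜)) (x : V),
      ‖x‖ ^ k * ‖iteratedFDeriv ℝ n (fun x => χ (q x) • φ (π x)) x‖
        ≤ C * (Finset.Iic (k, n)).sup (schwartzSeminormFamily 𝕜 r 𝕜) φ := by
  let S := (Finset.Iic (k, n)).sup (schwartzSeminormFamily ℝ V ℝ) χ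
  have hS : 0 ≤ S := apply_nonneg _ _
  refine ⟨∑ i ∈ Finset.range (n + 1), (n.choose i : ℝ) *
    ((2 ^ k * S) * ‖q‖ ^ i * (2 ^ k * ‖π‖ ^ (n - i))),
    Finset.sum_nonneg fun i _ => by positivity, fun φ x => ?_⟩
  set T := (Finset.Iic (k, n)).sup (schwartzSeminormFamily 𝕜 r 𝕜) φ with hTdef
  have hT : 0 ≤ T := apply_nonneg _ _
  have h1 := norm_iteratedFDeriv_smul_le (𝕜 := ℝ) (N := ∞) (n := n)
    ((χ.smooth ⊤).comp q.contDiff) ((φ.smooth ⊤).comp π.contDiff) x (mod_cast le_top)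
  have hx : ‖x‖ ^ k ≤ (1 + ‖q x‖) ^ k * (1 + ‖π x‖) ^ k := by
    rw [← mul_pow]
    refine pow_le_pow_left₀ (norm_nonneg _) ?_ k
    have h2 : ‖x‖ ≤ ‖π x‖ + ‖q x‖ := by
      conv_lhs => rw [← hq x]
      exact norm_add_le _ _
    nlinarith [norm_nonneg (q x), norm_nonneg (π x)]
  calc ‖x‖ ^ k * ‖iteratedFDeriv ℝ n (fun x => χ (q x) • φ (π x)) x‖
      ≤ ‖x‖ ^ k * ∑ i ∈ Finset.range (n + 1), (n.choose i : ℝ) *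
          ‖iteratedFDeriv ℝ i (χ ∘ q) x‖ * ‖iteratedFDeriv ℝ (n - i) (φ ∘ π) x‖ :=
        mul_le_mul_of_nonneg_left h1 (by positivity)
    _ ≤ _ := by
        rw [Finset.mul_sum, Finset.sum_mul]
        refine Finset.sum_le_sum fun i hi => ?_
        have hin : i ≤ n := Nat.lt_succ_iff.1 (Finset.mem_range.1 hi)
        have hχ := one_add_le_sup_seminorm_apply (𝕜 := ℝ) (m := (k, n)) (k := k) (n := i) le_rfl
          hin χ (q x)
        have hφ := one_add_le_sup_seminorm_apply (𝕜 := 𝕜) (m := (k, n)) (k := k) (n := n - i)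
          le_rfl (Nat.sub_le _ _) φ (π x)
        have hχ' := norm_iteratedFDeriv_comp_clm_le q (χ.smooth ⊤) x i
        have hφ' := norm_iteratedFDeriv_comp_clm_le π (φ.smooth ⊤) x (n - i)
        calc ‖x‖ ^ k * ((n.choose i : ℝ) * ‖iteratedFDeriv ℝ i (χ ∘ q) x‖ *
              ‖iteratedFDeriv ℝ (n - i) (φ ∘ π) x‖)
            ≤ ((1 + ‖q x‖) ^ k * (1 + ‖π x‖) ^ k) * ((n.choose i : ℝ) *
              (‖iteratedFDeriv ℝ i χ (q x)‖ * ‖q‖ ^ i) *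
              (‖iteratedFDeriv ℝ (n - i) φ (π x)‖ * ‖π‖ ^ (n - i))) := by gcongr
          _ = (n.choose i : ℝ) * (((1 + ‖q x‖) ^ k * ‖iteratedFDeriv ℝ i χ (q x)‖) * ‖q‖ ^ i *
              (((1 + ‖π x‖) ^ k * ‖iteratedFDeriv ℝ (n - i) φ (π x)‖) * ‖π‖ ^ (n - i))) := by ring
          _ ≤ (n.choose i : ℝ) * ((2 ^ k * S) * ‖q‖ ^ i * ((2 ^ k * T) * ‖π‖ ^ (n - i))) := by
              gcongr (n.choose i : ℝ) * (?_ * ‖q‖ ^ i * (?_ * ‖π‖ ^ (n - i)))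
              · exact hχ
              · exact hφ
          _ = _ := by ring

/-- The embedding of distributions on a subspace. -/
def distPush (r : Submodule ℝ V) : TempDist 𝕜 r →ₗ[𝕜] TempDist 𝕜 V :=
  (PointwiseConvergenceCLM.precomp 𝕜 (restrictSchwartz 𝕜 r) :
    TempDist 𝕜 r →L[𝕜] TempDist 𝕜 V)

@[simp]
theorem distPush_apply (r : Submodule ℝ V) (h : TempDist 𝕜 r) (φ : 𝓢(V, 𝕜)) :
    distPush r h φ = h (restrictSchwartz 𝕜 r φ) := rfl

theorem mem_distOnSubspace_iff {r : Submodule ℝ V} {f : TempDist 𝕜 V} :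
    f ∈ distOnSubspace 𝕜 r ↔ ∃ h, distPush r h = f := Iff.rfl

theorem restrictSchwartz_lineDerivOp (r : Submodule ℝ V) (b : r) (φ : 𝓢(V, 𝕜)) :
    restrictSchwartz 𝕜 r (∂_{(b : V)} φ) = ∂_{b} (restrictSchwartz 𝕜 r φ) := by
  ext y
  have h : HasFDerivAt (restrictSchwartz 𝕜 r φ : r → 𝕜)
      ((fderiv ℝ φ (y : V)).comp r.subtypeL) y :=
    (φ.hasFDerivAt (y : V)).comp y r.subtypeL.hasFDerivAt
  rw [restrictSchwartz_apply, lineDerivOp_apply_eq_fderiv, lineDerivOp_apply_eq_fderiv, h.fderiv]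
  rfl

theorem distPush_distDeriv (r : Submodule ℝ V) (b : r) (h : TempDist 𝕜 r) :
    distPush r (distDeriv 𝕜 b h) = distDeriv 𝕜 (b : V) (distPush r h) := by
  ext φ
  rw [distPush_apply, distDeriv_apply, distDeriv_apply, distPush_apply,
    restrictSchwartz_lineDerivOp]

theorem distPush_distDerivList (r : Submodule ℝ V) (Y : List r) (h : TempDist 𝕜 r) :
    distPush r (distDerivList 𝕜 Y h) = distDerivList 𝕜 (Y.map (↑)) (distPush r h) := by
  induction Y with
  | nil => rfl
  | cons b Y ih =>
    rw [List.map_cons, distDerivList_cons, distDerivList_cons, Module.End.mul_apply,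
      Module.End.mul_apply, distPush_distDeriv, ih]

variable [FiniteDimensional ℝ V]

/-- The restriction of Schwartz functions to a subspace has a continuous linear right inverse. -/
theorem exists_extension (r : Submodule ℝ V) :
    ∃ E : 𝓢(r, 𝕜) →L[𝕜] 𝓢(V, 𝕜), ∀ φ, restrictSchwartz 𝕜 r (E φ) = φ := by
  obtain ⟨χ, hχ⟩ : ∃ χ : 𝓢(V, ℝ), χ 0 = 1 := by
    let e : V ≃L[ℝ] EuclideanSpace ℝ (Fin (Module.finrank ℝ V)) :=
      ContinuousLinearEquiv.ofFinrankEq (by simp)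
    let f : ContDiffBump (0 : V) := ⟨1, 2, one_pos, one_lt_two⟩
    exact ⟨f.hasCompactSupport.toSchwartzMap f.contDiff,
      f.one_of_mem_closedBall (Metric.mem_closedBall_self f.rIn_pos.le)⟩
  obtain ⟨p, hp⟩ := LinearMap.exists_leftInverse_of_injective r.subtype
    (LinearMap.ker_eq_bot.2 r.injective_subtype)
  let π : V →L[ℝ] r := LinearMap.toContinuousLinearMap p
  let q : V →L[ℝ] V := ContinuousLinearMap.id ℝ V - r.subtypeL.comp π
  have hπ : ∀ y : r, π y = y := fun y => LinearMap.congr_fun hp y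
  have hq : ∀ x, (π x : V) + q x = x := fun x => by simp [q]
  refine ⟨mkCLM (fun φ x => χ (q x) • φ (π x)) (fun f g x => by simp)
    (fun c f x => by simp) (fun φ => ?_) ?_, fun φ => ?_⟩
  · exact ((χ.smooth ⊤).comp q.contDiff).smul ((φ.smooth ⊤).comp π.contDiff)
  · rintro ⟨k, n⟩
    obtain ⟨C, hC, h⟩ := exists_extension_bound (𝕜 := 𝕜) π q hq χ k n
    exact ⟨_, C, hC, h⟩
  · ext y
    change χ (q y) • φ (π y) = φ y
    -- On `r` the complementary projection vanishes, so the cutoff takes the value `χ 0 = 1`.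
    have : q y = 0 := by simp [q, hπ]
    rw [this, hχ, hπ, one_smul]

theorem distPush_injective (r : Submodule ℝ V) :
    Function.Injective (distPush (𝕜 := 𝕜) r) := by
  obtain ⟨E, hE⟩ := exists_extension (𝕜 := 𝕜) r
  intro h₁ h₂ h
  ext φ
  have := congrArg (fun f : TempDist 𝕜 V => f (E φ)) h
  simpa [hE] using this

/-- The preimage of `f` is `f ∘ E` for a continuous extension operator `E`: a function `φ` and the
extension of its restriction differ by a function vanishing on `r`. -/
theorem mem_distOnSubspace_of_forall {r : Submodule ℝ V} {f : TempDist 𝕜 V}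
    (hf : ∀ φ : 𝓢(V, 𝕜), (∀ y ∈ r, φ y = 0) → f φ = 0) : f ∈ distOnSubspace 𝕜 r := by
  obtain ⟨E, hE⟩ := exists_extension (𝕜 := 𝕜) r
  refine mem_distOnSubspace_iff.2
    ⟨(PointwiseConvergenceCLM.precomp 𝕜 E : TempDist 𝕜 V →L[𝕜] TempDist 𝕜 r) f, ?_⟩
  ext φ
  change f (E (restrictSchwartz 𝕜 r φ)) = f φ
  rw [← sub_eq_zero, ← map_sub]
  refine hf _ fun y hy => ?_
  have := congrArg (fun ψ : 𝓢(r, 𝕜) => ψ ⟨y, hy⟩) (hE (restrictSchwartz 𝕜 r φ))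
  simpa [sub_eq_zero] using this

end Extension

/-! ### Spline measures -/

section SplineMeasures

variable {V : Type*} [NormedAddCommGroup V] [NormedSpace ℝ V]

theorem isClosed_orthant (n : ℕ) : IsClosed {t : Fin n → ℝ | ∀ j, 0 ≤ t j} := by
  simp only [Set.ofPred_forall]
  exact isClosed_iInter fun j => isClosed_le continuous_const (continuous_apply j)

theorem continuous_splineMap (Z : List V) :
    Continuous (fun t : Fin Z.length → ℝ => ∑ j, t j • Z.get j) := by
  fun_prop

theorem exists_pos_le_of_forall_pos {Z : List V} {u : StrongDual ℝ V} (hu : ∀ z ∈ Z, 0 < u z) :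
    ∃ m > 0, ∀ z ∈ Z, m ≤ u z := by
  induction Z with
  | nil => exact ⟨1, one_pos, by simp⟩
  | cons z Z ih =>
    obtain ⟨m, hm, h⟩ := ih fun y hy => hu y (List.mem_cons_of_mem _ hy)
    refine ⟨min m (u z), lt_min hm (hu z List.mem_cons_self), ?_⟩
    simp only [List.mem_cons, forall_eq_or_imp]
    exact ⟨min_le_right _ _, fun y hy => (min_le_left _ _).trans (h y hy)⟩

variable [MeasurableSpace V] [BorelSpace V]

/-- The image of Lebesgue measure on `[0, ∞)` under `t ↦ t z`. -/
def rayMeasure (z : V) : Measure V :=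
  ((volume : Measure ℝ).restrict (Set.Ici 0)).map (fun t => t • z)

instance instSFiniteRayMeasure (z : V) : SFinite (rayMeasure z) := by
  unfold rayMeasure; infer_instance

theorem splineMeasure_nil : splineMeasure ([] : List V) = Measure.dirac 0 := by
  have h : {t : Fin ([] : List V).length → ℝ | ∀ j, 0 ≤ t j} = Set.univ := by
    ext t; simp only [Set.mem_ofPred_eq, Set.mem_univ, iff_true]; exact fun j => j.elim0
  have h2 : (volume : Measure (Fin ([] : List V).length → ℝ)) = Measure.dirac (fun _ => 0) := by
    rw [volume_pi]
    exact Measure.pi_of_empty (α := Fin 0) _ _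
  rw [splineMeasure, h, Measure.restrict_univ, h2, Measure.map_dirac' (continuous_splineMap _).measurable]
  congr 1

theorem ae_splineMeasure {Z : List V} {S : Set V} (hS : IsClosed S)
    (h : ∀ t : Fin Z.length → ℝ, (∀ j, 0 ≤ t j) → ∑ j, t j • Z.get j ∈ S) :
    ∀ᵐ x ∂splineMeasure Z, x ∈ S := by
  rw [splineMeasure, ae_map_iff (p := fun x => x ∈ S)
    (continuous_splineMap Z).measurable.aemeasurable hS.measurableSet,
    ae_restrict_iff' (isClosed_orthant _).measurableSet]
  exact Filter.Eventually.of_forall h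

theorem ae_splineMeasure_mem {Z : List V} {t : Submodule ℝ V} [FiniteDimensional ℝ V]
    (h : ∀ z ∈ Z, z ∈ t) : ∀ᵐ x ∂splineMeasure Z, x ∈ t :=
  ae_splineMeasure (S := (t : Set V)) t.closed_of_finiteDimensional fun _ _ =>
    t.sum_mem fun _ _ => t.smul_mem _ (h _ (List.get_mem _ _))

/-- The inequality holds for the finitely many generators with a common constant and passes to their
nonnegative combinations. -/
theorem exists_ae_norm_le {Z : List V} {u : StrongDual ℝ V} (hu : ∀ z ∈ Z, 0 < u z) :
    ∃ C ≥ 0, ∀ᵐ x ∂splineMeasure Z, ‖x‖ ≤ C * u x := by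
  obtain ⟨m, hm, hmu⟩ := exists_pos_le_of_forall_pos hu
  have hZ : ∀ j : Fin Z.length, ‖Z.get j‖ ≤ (∑ i, ‖Z.get i‖) / m * u (Z.get j) := by
    intro j
    have h1 : ‖Z.get j‖ ≤ ∑ i, ‖Z.get i‖ :=
      Finset.single_le_sum (f := fun i => ‖Z.get i‖) (fun i _ => norm_nonneg _) (Finset.mem_univ j)
    have h2 := hmu _ (List.get_mem Z j)
    rw [div_mul_eq_mul_div, le_div_iff₀ hm]
    exact mul_le_mul h1 h2 hm.le ((norm_nonneg _).trans h1)
  refine ⟨(∑ i, ‖Z.get i‖) / m, by positivity,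
    ae_splineMeasure (isClosed_le continuous_norm (by fun_prop)) fun t ht => ?_⟩
  change ‖_‖ ≤ _
  calc ‖∑ j, t j • Z.get j‖ ≤ ∑ j, ‖t j • Z.get j‖ := norm_sum_le _ _
    _ ≤ ∑ j, t j * ((∑ i, ‖Z.get i‖) / m * u (Z.get j)) := by
        refine Finset.sum_le_sum fun j _ => ?_
        rw [norm_smul, Real.norm_of_nonneg (ht j)]
        exact mul_le_mul_of_nonneg_left (hZ j) (ht j)
    _ = _ := by
        rw [map_sum, Finset.mul_sum]
        refine Finset.sum_congr rfl fun j _ => ?_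
        rw [map_smul, smul_eq_mul]; ring

theorem exists_integrable_splineMeasure {Z : List V} {u : StrongDual ℝ V}
    (hu : ∀ z ∈ Z, 0 < u z) :
    ∃ n : ℕ, Integrable (fun x : V => ((1 + ‖x‖) ^ n)⁻¹) (splineMeasure Z) := by
  obtain ⟨m, hm, hmu⟩ := exists_pos_le_of_forall_pos hu
  obtain ⟨n, hn⟩ := Measure.HasTemperateGrowth.exists_integrable
    (μ := (volume : Measure (Fin Z.length → ℝ)))
  refine ⟨n, ?_⟩
  have hcont : Continuous fun x : V => ((1 + ‖x‖) ^ n)⁻¹ :=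
    Continuous.inv₀ (by fun_prop) fun x => by positivity
  rw [splineMeasure, integrable_map_measure hcont.stronglyMeasurable.aestronglyMeasurable
    (continuous_splineMap Z).measurable.aemeasurable]
  -- On the orthant `m ‖t‖ ≤ u (∑ t_j z_j) ≤ (‖u‖ + 1) ‖∑ t_j z_j‖`. The `1` in the minimum handles
  -- the constant term of `1 + ‖t‖`, and `‖u‖ + 1` avoids a zero denominator.
  set δ := min 1 (m / (‖u‖ + 1)) with hδ
  have hδ0 : 0 < δ := lt_min one_pos (by positivity)
  have hle : ∀ t : Fin Z.length → ℝ, (∀ j, 0 ≤ t j) →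
      δ * (1 + ‖t‖) ≤ 1 + ‖∑ j, t j • Z.get j‖ := by
    intro t ht
    have h1 : ‖t‖ ≤ ∑ j, t j := by
      refine (pi_norm_le_iff_of_nonneg (Finset.sum_nonneg fun j _ => ht j)).2 fun j => ?_
      rw [Real.norm_of_nonneg (ht j)]
      exact Finset.single_le_sum (fun i _ => ht i) (Finset.mem_univ j)
    have h2 : m * ∑ j, t j ≤ u (∑ j, t j • Z.get j) := by
      rw [map_sum, Finset.mul_sum]
      refine Finset.sum_le_sum fun j _ => ?_
      rw [map_smul, smul_eq_mul, mul_comm]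
      exact mul_le_mul_of_nonneg_left (hmu _ (List.get_mem Z j)) (ht j)
    have h3 : u (∑ j, t j • Z.get j) ≤ (‖u‖ + 1) * ‖∑ j, t j • Z.get j‖ :=
      (le_abs_self _).trans ((u.le_opNorm _).trans
        (mul_le_mul_of_nonneg_right (by linarith) (norm_nonneg _)))
    have h4 : m / (‖u‖ + 1) * ‖t‖ ≤ ‖∑ j, t j • Z.get j‖ := by
      rw [div_mul_eq_mul_div, div_le_iff₀ (by positivity)]
      nlinarith
    have h5 : δ * ‖t‖ ≤ m / (‖u‖ + 1) * ‖t‖ :=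
      mul_le_mul_of_nonneg_right (min_le_right _ _) (norm_nonneg _)
    have h6 : δ ≤ 1 := min_le_left _ _
    linarith
  refine ((hn.const_mul ((δ ^ n)⁻¹)).restrict).mono' ?_ ?_
  · exact (hcont.comp (continuous_splineMap Z)).aestronglyMeasurable
  · rw [ae_restrict_iff' (isClosed_orthant _).measurableSet]
    refine Filter.Eventually.of_forall fun t ht => ?_
    have h7 : (0 : ℝ) < 1 + ‖t‖ := by positivity
    rw [Real.rpow_neg h7.le, Real.rpow_natCast, ← mul_inv, ← mul_pow, Function.comp_apply,
      Real.norm_of_nonneg (by positivity)]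
    exact inv_anti₀ (by positivity) (pow_le_pow_left₀ (by positivity) (hle t ht) n)

/-- Splitting off the first coordinate makes the spline an iterated convolution of rays, so its
independence of the order of the list is commutativity of convolution. -/
theorem splineMeasure_cons [FiniteDimensional ℝ V] (z : V) (Z : List V) :
    splineMeasure (z :: Z) = rayMeasure z ∗ splineMeasure Z := by
  have hmp := volume_preserving_piFinSuccAbove (fun _ : Fin (Z.length + 1) => ℝ) 0
  have hs : {t : Fin (z :: Z).length → ℝ | ∀ j, 0 ≤ t j}
      = (MeasurableEquiv.piFinSuccAbove (fun _ : Fin (Z.length + 1) => ℝ) 0) ⁻¹'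
        (Set.Ici 0 ×ˢ {t : Fin Z.length → ℝ | ∀ j, 0 ≤ t j}) := by
    ext t
    change (∀ j : Fin (Z.length + 1), 0 ≤ t j) ↔ _
    rw [Fin.forall_fin_succ]
    rfl
  have hm : MeasurableSet (Set.Ici (0 : ℝ) ×ˢ {t : Fin Z.length → ℝ | ∀ j, 0 ≤ t j}) := by
    refine measurableSet_Ici.prod ?_
    exact (isClosed_orthant Z.length).measurableSet
  have hmp' := hmp.restrict_preimage hm
  rw [Measure.conv, rayMeasure, splineMeasure, splineMeasure,
    Measure.map_prod_map _ _ (by fun_prop) (by fun_prop), Measure.map_map (by fun_prop)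
      (by fun_prop), Measure.prod_restrict, ← Measure.volume_eq_prod]
  rw [hs]
  have := hmp'.map_eq
  rw [← this, Measure.map_map (by fun_prop) (MeasurableEquiv.measurable _)]
  congr 1
  ext t
  change ∑ j : Fin (Z.length + 1), t j • (z :: Z).get j = _
  rw [Fin.sum_univ_succ]
  rfl

theorem splineMeasure_perm [FiniteDimensional ℝ V] {Y Z : List V} (h : Y.Perm Z) :
    splineMeasure Y = splineMeasure Z := by
  induction h with
  | nil => rfl
  | cons z _ ih => rw [splineMeasure_cons, splineMeasure_cons, ih]
  | swap y z Z =>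
    rw [splineMeasure_cons, splineMeasure_cons, splineMeasure_cons, splineMeasure_cons,
      ← Measure.conv_assoc, ← Measure.conv_assoc, Measure.conv_comm (rayMeasure z)]
  | trans _ _ ih₁ ih₂ => exact ih₁.trans ih₂

/-- Integration against the spline measure of `z :: Z` and a further s-finite measure. -/
theorem integral_splineMeasure_cons_prod [FiniteDimensional ℝ V] {T E : Type*}
    [TopologicalSpace T] [MeasurableSpace T] [BorelSpace T] [SecondCountableTopology T]
    [NormedAddCommGroup E] [NormedSpace ℝ E] [SecondCountableTopology E]
    {μ : Measure T} [SFinite μ] {z : V} {Z : List V} {f : V × T → E} (hf : Continuous f)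
    (hint : Integrable f ((splineMeasure (z :: Z)).prod μ)) :
    ∫ p, f p ∂((splineMeasure (z :: Z)).prod μ)
      = ∫ p, (∫ t in Set.Ioi (0 : ℝ), f (t • z + p.1, p.2)) ∂((splineMeasure Z).prod μ) := by
  have hg : Measurable fun q : ℝ × V × T => ((q.1 • z + q.2.1, q.2.2) : V × T) := by fun_prop
  have h1 : (splineMeasure (z :: Z)).prod μ
      = (((volume : Measure ℝ).restrict (Set.Ici 0)).prod ((splineMeasure Z).prod μ)).map
          fun q : ℝ × V × T => ((q.1 • z + q.2.1, q.2.2) : V × T) := by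
    have h2 : rayMeasure z ∗ splineMeasure Z
        = (((volume : Measure ℝ).restrict (Set.Ici 0)).prod (splineMeasure Z)).map
          fun q : ℝ × V => q.1 • z + q.2 := by
      conv_lhs => rw [Measure.conv, rayMeasure, ← Measure.map_id (μ := splineMeasure Z)]
      rw [Measure.map_prod_map _ _ (by fun_prop) (by fun_prop),
        Measure.map_map (by fun_prop) (by fun_prop)]
      rfl
    rw [splineMeasure_cons, h2]
    conv_lhs => rw [← Measure.map_id (μ := μ)]
    rw [Measure.map_prod_map _ _ (by fun_prop) (by fun_prop)]
    rw [← (measurePreserving_prodAssoc ((volume : Measure ℝ).restrict (Set.Ici 0))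
      (splineMeasure Z) μ).map_eq, Measure.map_map (by fun_prop) (by fun_prop)]
    rfl
  rw [h1] at hint ⊢
  rw [integrable_map_measure hf.aestronglyMeasurable hg.aemeasurable] at hint
  rw [integral_map hg.aemeasurable hf.aestronglyMeasurable]
  refine (integral_prod_symm _ hint).trans ?_
  simp only [Function.comp_apply, integral_Ici_eq_integral_Ioi]

end SplineMeasures

/-! ### Convolutions of spline measures with polynomial densities -/

section Convolution

open LineDeriv

variable {𝕜 : Type*} [RCLike 𝕜] {V : Type*} [NormedAddCommGroup V] [NormedSpace ℝ V]

theorem continuous_convIntegrand {r : Submodule ℝ V} {g : r → 𝕜} (hg : Continuous g)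
    (φ : 𝓢(V, 𝕜)) : Continuous (convIntegrand r g φ) :=
  (φ.continuous.comp (by fun_prop)).mul (hg.comp continuous_snd)

/-- Since `z ≠ 0`, `t ↦ φ (t z + w)` is a Schwartz function on `ℝ`; the integral of its derivative
leaves only the boundary term at `0`. -/
theorem integral_Ioi_lineDeriv {z : V} (hz : z ≠ 0) (w : V) (φ : 𝓢(V, 𝕜)) :
    ∫ t in Set.Ioi (0 : ℝ), (∂_{z} φ : 𝓢(V, 𝕜)) (t • z + w) = -φ w := by
  have hanti : AntilipschitzWith (‖z‖₊⁻¹) (fun t : ℝ => t • z) := by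
    refine AntilipschitzWith.of_le_mul_dist fun s t => ?_
    rw [dist_eq_norm, dist_eq_norm, ← sub_smul, norm_smul, NNReal.coe_inv, coe_nnnorm]
    rw [mul_comm, mul_assoc, mul_inv_cancel₀ (norm_ne_zero_iff.2 hz), mul_one]
  let ψ : 𝓢(ℝ, 𝕜) := compCLMOfAntilipschitz (K := ‖z‖₊⁻¹) (g := fun t : ℝ => t • z) 𝕜
    (((ContinuousLinearMap.id ℝ ℝ).smulRight z).hasTemperateGrowth) hanti
    (compSubConstCLM 𝕜 (-w) φ)
  have hψ : ∀ t, ψ t = φ (t • z + w) := fun t => by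
    change φ (t • z - -w) = _
    rw [sub_neg_eq_add]
  have hd : ∀ t, HasDerivAt ψ ((∂_{z} φ : 𝓢(V, 𝕜)) (t • z + w)) t := by
    intro t
    have h1 : HasDerivAt (fun t : ℝ => t • z + w) z t := by
      simpa using ((hasDerivAt_id t).smul_const z).add_const w
    have h2 := (φ.hasFDerivAt (t • z + w)).comp_hasDerivAt t h1
    rw [lineDerivOp_apply_eq_fderiv]
    exact h2.congr_of_eventuallyEq (Filter.Eventually.of_forall hψ)
  have hint : Integrable (fun t : ℝ => (∂_{z} φ : 𝓢(V, 𝕜)) (t • z + w)) := by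
    refine (derivCLM 𝕜 𝕜 ψ).integrable.congr (Filter.Eventually.of_forall fun t => ?_)
    exact (hd t).deriv
  have hlim : Filter.Tendsto ψ Filter.atTop (nhds 0) :=
    ψ.tendsto_cocompact.mono_left atTop_le_cocompact
  rw [integral_Ioi_of_hasDerivAt_of_tendsto' (fun t _ => hd t) hint.integrableOn hlim, hψ]
  simp

variable [MeasurableSpace V] [BorelSpace V] [FiniteDimensional ℝ V]
  {r : Submodule ℝ V} {Z : List V} {u : StrongDual ℝ V}

theorem integral_convIntegrand_eq_zero {μ : Measure r} [SFinite μ] {t : Submodule ℝ V} (hZt : ∀ z ∈ Z, z ∈ t) (hrt : r ≤ t)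
    (g : r → 𝕜) {φ : 𝓢(V, 𝕜)} (hφ : ∀ y ∈ t, φ y = 0) :
    ∫ p, convIntegrand r g φ p ∂((splineMeasure Z).prod μ) = 0 := by
  have h := Measure.quasiMeasurePreserving_fst (μ := splineMeasure Z) (ν := μ) |>.ae
    (ae_splineMeasure_mem hZt)
  refine integral_eq_zero_of_ae ?_
  filter_upwards [h] with p hp
  simp [convIntegrand, hφ _ (t.add_mem hp (hrt p.2.2))]

theorem integral_convIntegrand_nil {μ : Measure r} [SFinite μ] (g : r → 𝕜) (hg : Continuous g) (φ : 𝓢(V, 𝕜)) :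
    ∫ p, convIntegrand r g φ p ∂((splineMeasure ([] : List V)).prod μ)
      = ∫ y : r, φ (y : V) * g y ∂μ := by
  rw [splineMeasure_nil, Measure.dirac_prod, integral_map (by fun_prop)
    (continuous_convIntegrand hg φ).aestronglyMeasurable]
  simp [convIntegrand]

variable {μ : Measure r} [μ.IsAddHaarMeasure]

/-- On the cone `‖x‖ ≤ C₀ u(x) = C₀ u(x + y)`, because `u` vanishes on `r`; so the size of `x + y`
controls both `x` and `y`, and decay of `φ` gives decay in both variables. The majorant `G` does not
depend on `φ`, which yields continuity as well as integrability. -/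
theorem exists_convIntegrand_bound (hu : ∀ z ∈ Z, 0 < u z) (hur : ∀ y ∈ r, u y = 0)
    {g : r → 𝕜} (hg : g.HasTemperateGrowth) :
    ∃ (G : V × r → ℝ) (M : ℕ), Integrable G ((splineMeasure Z).prod μ) ∧ (∀ p, 0 ≤ G p) ∧
      ∀ φ : 𝓢(V, 𝕜), ∀ᵐ p ∂((splineMeasure Z).prod μ), ‖convIntegrand r g φ p‖
        ≤ G p * (Finset.Iic (M, 0)).sup (schwartzSeminormFamily 𝕜 V 𝕜) φ := by
  obtain ⟨C₀, hC₀, hcone⟩ := exists_ae_norm_le hu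
  obtain ⟨n₁, hn₁⟩ := exists_integrable_splineMeasure hu
  obtain ⟨n₂, hn₂⟩ := Measure.HasTemperateGrowth.exists_integrable (μ := μ)
  obtain ⟨k, C, hC⟩ := hg.2 0
  simp only [norm_iteratedFDeriv_zero] at hC
  have hC0 : 0 ≤ C := by simpa using (norm_nonneg _).trans (hC 0)
  have hn₂' : Integrable (fun y : r => ((1 + ‖y‖) ^ n₂)⁻¹) μ := by
    refine hn₂.congr (Filter.Eventually.of_forall fun y => ?_)
    change (1 + ‖y‖) ^ (-(n₂ : ℝ)) = _
    rw [Real.rpow_neg (by positivity), Real.rpow_natCast]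
  set K := 1 + C₀ * ‖u‖ with hK
  have hK1 : 1 ≤ K := by rw [hK]; have := mul_nonneg hC₀ (norm_nonneg u); linarith
  -- `k` powers absorb the growth of `g`; `n₁` and `n₂` make the two factors integrable.
  set M := k + n₁ + n₂ with hM
  refine ⟨fun p => (C * (K ^ M * 2 ^ M)) * (((1 + ‖p.1‖) ^ n₁)⁻¹ * ((1 + ‖p.2‖) ^ n₂)⁻¹), M,
    (hn₁.mul_prod hn₂').const_mul _, fun p => by positivity, fun φ => ?_⟩
  have hcone' := Measure.quasiMeasurePreserving_fst (μ := splineMeasure Z) (ν := μ) |>.ae hcone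
  filter_upwards [hcone'] with p hp
  set S := (Finset.Iic (M, 0)).sup (schwartzSeminormFamily 𝕜 V 𝕜) φ with hS
  have hφ : (1 + ‖p.1 + (p.2 : V)‖) ^ M * ‖φ (p.1 + (p.2 : V))‖ ≤ 2 ^ M * S := by
    have := one_add_le_sup_seminorm_apply (𝕜 := 𝕜) (m := (M, 0)) (k := M) (n := 0) le_rfl le_rfl φ
      (p.1 + (p.2 : V))
    rwa [norm_iteratedFDeriv_zero] at this
  have hx : ‖p.1‖ ≤ C₀ * ‖u‖ * ‖p.1 + (p.2 : V)‖ := by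
    have h1 : u p.1 = u (p.1 + (p.2 : V)) := by rw [map_add, hur _ p.2.2, add_zero]
    rw [h1] at hp
    calc ‖p.1‖ ≤ C₀ * u (p.1 + (p.2 : V)) := hp
      _ ≤ C₀ * (‖u‖ * ‖p.1 + (p.2 : V)‖) :=
        mul_le_mul_of_nonneg_left ((le_abs_self _).trans (u.le_opNorm _)) hC₀
      _ = _ := by ring
  have hy : ‖p.2‖ ≤ ‖p.1 + (p.2 : V)‖ + ‖p.1‖ := by
    have h1 : (p.2 : V) = (p.1 + (p.2 : V)) - p.1 := by abel
    have h2 : ‖p.2‖ = ‖(p.2 : V)‖ := rfl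
    rw [h2]
    conv_lhs => rw [h1]
    exact norm_sub_le _ _
  set w := ‖p.1 + (p.2 : V)‖ with hw
  have hw0 : 0 ≤ w := norm_nonneg _
  have ha : 1 + ‖p.1‖ ≤ K * (1 + w) := by nlinarith
  have hb : 1 + ‖p.2‖ ≤ K * (1 + w) := by nlinarith
  have key : ‖φ (p.1 + (p.2 : V))‖ * (1 + ‖p.2‖) ^ k * ((1 + ‖p.1‖) ^ n₁ * (1 + ‖p.2‖) ^ n₂)
      ≤ K ^ M * 2 ^ M * S := by
    calc ‖φ (p.1 + (p.2 : V))‖ * (1 + ‖p.2‖) ^ k * ((1 + ‖p.1‖) ^ n₁ * (1 + ‖p.2‖) ^ n₂)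
        ≤ ‖φ (p.1 + (p.2 : V))‖ * (K * (1 + w)) ^ k *
            ((K * (1 + w)) ^ n₁ * (K * (1 + w)) ^ n₂) := by gcongr
      _ = K ^ M * ((1 + w) ^ M * ‖φ (p.1 + (p.2 : V))‖) := by
        rw [hM]; simp only [mul_pow, pow_add]; ring
      _ ≤ K ^ M * (2 ^ M * S) := by gcongr K ^ M * ?_
      _ = _ := by ring
  calc ‖convIntegrand r g φ p‖ = ‖φ (p.1 + (p.2 : V))‖ * ‖g p.2‖ := norm_mul _ _
    _ ≤ ‖φ (p.1 + (p.2 : V))‖ * (C * (1 + ‖p.2‖) ^ k) := by gcongr; exact hC _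
    _ = C * (‖φ (p.1 + (p.2 : V))‖ * (1 + ‖p.2‖) ^ k *
          ((1 + ‖p.1‖) ^ n₁ * (1 + ‖p.2‖) ^ n₂)) *
          (((1 + ‖p.1‖) ^ n₁)⁻¹ * ((1 + ‖p.2‖) ^ n₂)⁻¹) := by field_simp
    _ ≤ C * (K ^ M * 2 ^ M * S) * (((1 + ‖p.1‖) ^ n₁)⁻¹ * ((1 + ‖p.2‖) ^ n₂)⁻¹) := by gcongr
    _ = _ := by ring

theorem integrable_convIntegrand (hu : ∀ z ∈ Z, 0 < u z) (hur : ∀ y ∈ r, u y = 0)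
    {g : r → 𝕜} (hg : g.HasTemperateGrowth) (φ : 𝓢(V, 𝕜)) :
    Integrable (convIntegrand r g φ) ((splineMeasure Z).prod μ) := by
  obtain ⟨G, M, hG, -, h⟩ := exists_convIntegrand_bound (μ := μ) hu hur hg
  exact (hG.mul_const _).mono' (continuous_convIntegrand hg.1.continuous φ).aestronglyMeasurable
    (h φ)

variable (μ) in
theorem exists_convDist (hu : ∀ z ∈ Z, 0 < u z) (hur : ∀ y ∈ r, u y = 0)
    {g : r → 𝕜} (hg : g.HasTemperateGrowth) :
    ∃ T : TempDist 𝕜 V, ∀ φ,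
      T φ = ∫ p, convIntegrand r g φ p ∂((splineMeasure Z).prod μ) := by
  obtain ⟨G, M, hG, hG0, h⟩ := exists_convIntegrand_bound (μ := μ) hu hur hg
  have hint := integrable_convIntegrand (μ := μ) hu hur hg
  let L : 𝓢(V, 𝕜) →L[𝕜] 𝕜 := mkCLMtoNormedSpace
    (fun φ => ∫ p, convIntegrand r g φ p ∂((splineMeasure Z).prod μ))
    (fun φ ψ => by
      rw [← integral_add (hint φ) (hint ψ)]
      refine integral_congr_ae (Filter.Eventually.of_forall fun p => ?_)
      simp [convIntegrand, add_mul])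
    (fun c φ => by
      rw [RingHom.id_apply, smul_eq_mul, ← integral_const_mul]
      refine integral_congr_ae (Filter.Eventually.of_forall fun p => ?_)
      simp [convIntegrand, mul_assoc])
    ⟨Finset.Iic (M, 0), ∫ p, G p ∂((splineMeasure Z).prod μ), integral_nonneg hG0, fun φ => by
      refine (norm_integral_le_of_norm_le (hG.mul_const _) (h φ)).trans_eq ?_
      rw [integral_mul_const]⟩
  exact ⟨ContinuousLinearMap.toPointwiseConvergenceCLM _ _ _ _ L, fun φ => rfl⟩

/-- Differentiating in the direction of a vector of the list removes the vector. -/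
theorem integral_convIntegrand_lineDeriv_cons {z : V} (hz : 0 < u z) (hu : ∀ z ∈ Z, 0 < u z)
    (hur : ∀ y ∈ r, u y = 0) {g : r → 𝕜} (hg : g.HasTemperateGrowth) (φ : 𝓢(V, 𝕜)) :
    ∫ p, convIntegrand r g (∂_{z} φ) p ∂((splineMeasure (z :: Z)).prod μ)
      = -∫ p, convIntegrand r g φ p ∂((splineMeasure Z).prod μ) := by
  have hz0 : z ≠ 0 := by
    rintro rfl
    simp at hz
  have hu' : ∀ y ∈ z :: Z, 0 < u y := by
    simp only [List.mem_cons, forall_eq_or_imp]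
    exact ⟨hz, hu⟩
  rw [integral_splineMeasure_cons_prod (continuous_convIntegrand hg.1.continuous _)
    (integrable_convIntegrand hu' hur hg _), ← integral_neg]
  refine integral_congr_ae (Filter.Eventually.of_forall fun p => ?_)
  simp only [convIntegrand, add_assoc]
  rw [integral_mul_const, integral_Ioi_lineDeriv hz0, neg_mul]

/-- Integration by parts on `r`. -/
theorem integral_convIntegrand_lineDeriv (hu : ∀ z ∈ Z, 0 < u z) (hur : ∀ y ∈ r, u y = 0)
    {g : r → 𝕜} (hg : g ∈ polyFun 𝕜 r) (b : r) (φ : 𝓢(V, 𝕜)) :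
    ∫ p, convIntegrand r g (∂_{(b : V)} φ) p ∂((splineMeasure Z).prod μ)
      = -∫ p, convIntegrand r (dirDeriv 𝕜 b g) φ p ∂((splineMeasure Z).prod μ) := by
  have hg' := hasTemperateGrowth_of_mem_polyFun hg
  have hdg := hasTemperateGrowth_of_mem_polyFun ((polyFun_aux hg).2 b)
  rw [integral_prod _ (integrable_convIntegrand hu hur hg' _),
    integral_prod _ (integrable_convIntegrand hu hur hdg _), ← integral_neg]
  refine integral_congr_ae (Filter.Eventually.of_forall fun x => ?_)
  let ψ : 𝓢(r, 𝕜) := restrictSchwartz 𝕜 r (compSubConstCLM 𝕜 (-x) φ)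
  have hψ : ∀ y : r, ψ y = φ (x + y) := fun y => by
    change φ ((y : V) - -x) = _
    rw [sub_neg_eq_add, add_comm]
  have hdψ : ∀ y : r, fderiv ℝ ψ y b = (∂_{(b : V)} φ : 𝓢(V, 𝕜)) (x + y) := by
    intro y
    have h1 : HasFDerivAt (fun y : r => x + (y : V)) r.subtypeL y :=
      (r.subtypeL.hasFDerivAt (x := y)).const_add x
    have h2 := ((φ.hasFDerivAt (x + (y : V))).comp y h1).congr_of_eventuallyEq
      (Filter.Eventually.of_forall hψ)
    rw [h2.fderiv]
    rfl
  have hibp := integral_mul_fderiv_eq_neg_fderiv_mul_of_integrable (μ := μ) (f := g)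
    (g := ψ) (v := b) ?_ ?_ ?_ (fun y _ => (polyFun_aux hg).1 y) (fun y _ => ψ.differentiableAt)
  · simp only [convIntegrand]
    calc ∫ y : r, (∂_{(b : V)} φ : 𝓢(V, 𝕜)) (x + y) * g y ∂μ
        = ∫ y : r, g y * fderiv ℝ ψ y b ∂μ := by simp_rw [hdψ, mul_comm]
      _ = -∫ y : r, fderiv ℝ g y b * ψ y ∂μ := hibp
      _ = _ := by simp_rw [hψ, dirDeriv, mul_comm]
  · refine (integrable_schwartz_mul hdg ψ).congr (Filter.Eventually.of_forall fun y => ?_)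
    simp [dirDeriv, mul_comm]
  · refine (integrable_schwartz_mul hg' (∂_{b} ψ : 𝓢(r, 𝕜))).congr
      (Filter.Eventually.of_forall fun y => ?_)
    simp [lineDerivOp_apply_eq_fderiv, mul_comm]
  · refine (integrable_schwartz_mul hg' ψ).congr (Filter.Eventually.of_forall fun y => ?_)
    simp [mul_comm]

end Convolution

/-! ### Sublists attached to subspaces -/

section Sublists

variable {V : Type*} [AddCommGroup V] [Module ℝ V]

open Classical in
/-- The vectors of `X ∖ s` that lie in `t`. -/
def listBetween (X : List V) (s t : Submodule ℝ V) : List V :=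
  (listDiff X s).filter (fun a => a ∈ t)

theorem mem_listBetween {X : List V} {s t : Submodule ℝ V} {a : V} :
    a ∈ listBetween X s t ↔ a ∈ X ∧ a ∉ s ∧ a ∈ t := by
  classical
  simp [listBetween, mem_listDiff, and_assoc]

theorem listBetween_self (X : List V) (s : Submodule ℝ V) : listBetween X s s = [] := by
  refine List.eq_nil_iff_forall_not_mem.2 fun a ha => ?_
  rw [mem_listBetween] at ha
  exact ha.2.1 ha.2.2

theorem listDiff_perm (X : List V) (s t : Submodule ℝ V) :
    (listDiff X s).Perm (listDiff (listDiff X s) t ++ listBetween X s t) := by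
  classical
  have h := (List.filter_append_perm (fun a => decide (a ∈ t)) (listDiff X s)).symm
  refine h.trans (List.perm_append_comm.trans ?_)
  refine List.Perm.of_eq ?_
  rw [listBetween]
  congr 1
  rw [listDiff]
  congr 1
  ext a
  simp

theorem listDiff_listDiff (X : List V) {s t : Submodule ℝ V} (h : s ≤ t) :
    listDiff (listDiff X s) t = listDiff X t := by
  classical
  rw [listDiff, listDiff, List.filter_filter, listDiff]
  refine List.filter_congr fun a _ => ?_
  by_cases ha : a ∈ t
  · simp [ha]
  · have hs : a ∉ s := fun h' => ha (h h')
    simp [ha, hs]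

theorem mem_listInter {X : List V} {r : Submodule ℝ V} {b : r} :
    b ∈ listInter X r ↔ (b : V) ∈ X := by
  classical
  rw [listInter, List.mem_filterMap]
  constructor
  · rintro ⟨a, ha, h⟩
    by_cases har : a ∈ r
    · simp only [har, dite_true, Option.some.injEq] at h
      rw [← h]; exact ha
    · simp [har] at h
  · intro hb
    exact ⟨b, hb, by simp⟩

theorem map_coe_listInter (X : List V) (r : Submodule ℝ V) [DecidablePred (· ∈ r)] :
    (listInter X r).map (fun b : r => (b : V)) = X.filter (fun a => a ∈ r) := by
  classical
  rw [listInter, List.map_filterMap]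
  induction X with
  | nil => rfl
  | cons a X ih =>
    by_cases har : a ∈ r
    · rw [List.filterMap_cons_some (b := a) (by simp [har]), ih]
      simp [har]
    · rw [List.filterMap_cons_none (by simp [har]), ih]
      simp [har]

theorem map_coe_filter_listInter (X : List V) (r : Submodule ℝ V) (p : V → Prop)
    [DecidablePred p] [DecidablePred (· ∈ r)] :
    (List.filter (fun b : r => decide (p (b : V))) (listInter X r)).map (fun b : r => (b : V))
      = (X.filter (fun a => decide (p a))).filter (fun a => decide (a ∈ r)) := by
  have h := List.filter_map (f := fun b : r => (b : V)) (p := fun a => decide (p a))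
    (l := listInter X r)
  rw [map_coe_listInter] at h
  rw [List.filter_filter] at h ⊢
  refine h.symm.trans (List.filter_congr fun a _ => Bool.and_comm _ _)

theorem span_listInter {X : List V} {r : Submodule ℝ V} (hr : IsRational X r) :
    Submodule.span ℝ {b | b ∈ listInter X r} = ⊤ := by
  have h : Submodule.map r.subtype (Submodule.span ℝ {b | b ∈ listInter X r}) = r := by
    rw [Submodule.map_span]
    conv_rhs => rw [hr]
    congr 1
    ext a
    simp only [Set.mem_image, Set.mem_ofPred_eq, mem_listInter]
    exact ⟨fun ⟨b, hb, hba⟩ => hba ▸ ⟨hb, b.2⟩, fun ⟨haX, har⟩ => ⟨⟨a, har⟩, haX, rfl⟩⟩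
  refine Submodule.map_injective_of_injective r.injective_subtype ?_
  rw [h, Submodule.map_top, Submodule.range_subtype]

theorem isRational_map_subtype {X : List V} {r : Submodule ℝ V} {H : Submodule ℝ r}
    (hH : IsRational (listInter X r) H) : IsRational X (H.map r.subtype) := by
  refine IsRational.of_le_span (S := r.subtype '' {b | b ∈ listInter X r ∧ b ∈ H}) ?_ ?_
  · rintro _ ⟨b, hb, rfl⟩
    exact mem_listInter.1 hb.1
  · conv_lhs => rw [hH]
    rw [Submodule.map_span]

/-- Translates cocircuit equations on `r` into the equations that define `𝒢(X)_i`, for `i` the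
dimension of `r`. -/
theorem listDiff_map_subtype_perm (X : List V) {r : Submodule ℝ V} (H : Submodule ℝ r) :
    (listDiff X (H.map r.subtype)).Perm
      ((listDiff (listInter X r) H).map (fun b : r => (b : V)) ++ listDiff X r) := by
  classical
  have h1 := listDiff_perm X (H.map r.subtype) r
  rw [listDiff_listDiff X (Submodule.map_subtype_le r H)] at h1
  refine h1.trans (List.perm_append_comm.trans (List.Perm.of_eq ?_))
  congr 1
  rw [listBetween, listDiff, listDiff]
  have h2 := map_coe_filter_listInter X r (fun a => a ∉ H.map r.subtype)
  rw [← h2]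
  congr 1
  refine List.filter_congr fun b _ => ?_
  simp

end Sublists

/-! ### Regular faces -/

section Faces

variable {V : Type*} [NormedAddCommGroup V] [NormedSpace ℝ V]

theorem faceSign_eq_or (F : Set (StrongDual ℝ V)) (a : V) :
    faceSign F a = 1 ∨ faceSign F a = -1 := by
  unfold faceSign
  split_ifs
  exacts [Or.inl rfl, Or.inr rfl]

/-- Evaluation at `a` has no zero on the connected set `F`, so by the intermediate value theorem its
sign is constant there. -/
theorem faceSign_mul_pos {Z : List V} {F : Set (StrongDual ℝ V)} (hF : IsRegularFace Z F)
    {u : StrongDual ℝ V} (hu : u ∈ F) {a : V} (ha : a ∈ Z) : 0 < faceSign F a * u a := by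
  obtain ⟨u₀, -, rfl⟩ := hF
  set S := {u : StrongDual ℝ V | ∀ a ∈ Z, u a ≠ 0} with hS
  have hpre : IsPreconnected (connectedComponentIn S u₀) := isPreconnected_connectedComponentIn
  have hne : ∀ v ∈ connectedComponentIn S u₀, v a ≠ 0 := fun v hv =>
    connectedComponentIn_subset S u₀ hv a ha
  have hcont : ContinuousOn (fun v : StrongDual ℝ V => v a) (connectedComponentIn S u₀) := by
    fun_prop
  rcases lt_or_gt_of_ne (hne u hu) with h | h
  · have : ¬ ∀ v ∈ connectedComponentIn S u₀, 0 < v a := fun h' => (h' u hu).not_gt h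
    rw [faceSign, if_neg this]
    linarith
  · have : ∀ v ∈ connectedComponentIn S u₀, 0 < v a := by
      intro v hv
      by_contra hneg
      obtain ⟨w, hw, hw0⟩ := hpre.intermediate_value hv hu hcont ⟨not_lt.1 hneg, h.le⟩
      exact hne w hw hw0
    rw [faceSign, if_pos this, one_mul]
    exact h

open Classical in
theorem neg_one_pow_length_filter_cons (𝕜 : Type*) [RCLike 𝕜] (F : Set (StrongDual ℝ V)) (a : V)
    (Z : List V) :
    (-1 : 𝕜) ^ ((a :: Z).filter (fun a => ¬ ∀ u ∈ F, 0 < u a)).length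
      = ((faceSign F a : ℝ) : 𝕜) * (-1) ^ (Z.filter (fun a => ¬ ∀ u ∈ F, 0 < u a)).length := by
  by_cases h : ∀ u ∈ F, 0 < u a
  · rw [List.filter_cons_of_neg (by simpa using h), faceSign, if_pos h]
    simp
  · rw [List.filter_cons_of_pos (by simpa using h), faceSign, if_neg h, List.length_cons, pow_succ]
    simp

theorem signedList_cons (F : Set (StrongDual ℝ V)) (a : V) (Z : List V) :
    signedList (a :: Z) F = (faceSign F a • a) :: signedList Z F := rfl

theorem signedList_pos {Z : List V} {F : Set (StrongDual ℝ V)} {u : StrongDual ℝ V}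
    (hu : ∀ a ∈ Z, 0 < faceSign F a * u a) :
    ∀ z ∈ signedList Z F, 0 < u z := by
  intro z hz
  obtain ⟨a, ha, rfl⟩ := List.mem_map.1 hz
  simpa using hu a ha

end Faces

/-! ### The convolutions as distributions -/

section ConvolutionDistributions

open LineDeriv

variable {𝕜 : Type*} [RCLike 𝕜] {V : Type*} [NormedAddCommGroup V] [NormedSpace ℝ V]
  [MeasurableSpace V] [BorelSpace V] [FiniteDimensional ℝ V]
  {Λ : Submodule ℤ V} {F : Set (StrongDual ℝ V)} {r : Submodule ℝ V} {u : StrongDual ℝ V}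
  {Z : List V}

/-- Rationality is what makes `Λ ∩ r` a full lattice in `r`: it contains the spanning list `X ∩ r`.
Its covolume is then positive. -/
theorem isAddHaarMeasure_latticeMeasure [DiscreteTopology Λ] {X : List V}
    (hXΛ : ∀ a ∈ X, a ∈ Λ) (hr : IsRational X r) : (latticeMeasure Λ r).IsAddHaarMeasure := by
  have h1 : DiscreteTopology (ZLattice.comap ℝ Λ r.subtype) :=
    ZLattice.comap_discreteTopology ℝ Λ r.subtypeL.continuous r.injective_subtype
  have h2 : IsZLattice ℝ (ZLattice.comap ℝ Λ r.subtype) := by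
    refine ⟨top_le_iff.1 ?_⟩
    rw [← span_listInter hr]
    refine Submodule.span_mono fun b hb => ?_
    exact hXΛ _ (mem_listInter.1 hb)
  have h3 := ZLattice.covolume_pos (ZLattice.comap ℝ Λ r.subtype)
    (Measure.addHaar : Measure r)
  unfold latticeMeasure
  refine Measure.IsAddHaarMeasure.smul _ (ENNReal.inv_ne_zero.2 ENNReal.ofReal_ne_top)
    (ENNReal.inv_ne_top.2 ?_)
  simpa using h3

/-- `T` is the convolution `T_Z^F * g`. -/
def IsConv (Λ : Submodule ℤ V) (Z : List V) (F : Set (StrongDual ℝ V)) (r : Submodule ℝ V)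
    (g : r → 𝕜) (T : TempDist 𝕜 V) : Prop := ∀ φ, T φ = convPairing Λ Z F r g φ

theorem convPairing_perm {Y : List V} (h : Y.Perm Z) (g : r → 𝕜) (φ : 𝓢(V, 𝕜)) :
    convPairing Λ Y F r g φ = convPairing Λ Z F r g φ := by
  unfold convPairing
  rw [(h.filter _).length_eq, splineMeasure_perm (Y := signedList Y F) (h.map _)]
  rfl

theorem IsConv.perm {Y : List V} (h : Y.Perm Z) {g : r → 𝕜} {T : TempDist 𝕜 V}
    (hT : IsConv Λ Y F r g T) : IsConv Λ Z F r g T :=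
  fun φ => (hT φ).trans (convPairing_perm h g φ)

theorem IsConv.unique {g : r → 𝕜} {T T' : TempDist 𝕜 V} (hT : IsConv Λ Z F r g T)
    (hT' : IsConv Λ Z F r g T') : T = T' := by
  ext φ
  rw [hT, hT']

theorem IsConv.eq_zero {T : TempDist 𝕜 V} (hT : IsConv Λ Z F r 0 T) : T = 0 := by
  ext φ
  rw [hT, convPairing]
  have : ∀ p, convIntegrand r (0 : r → 𝕜) φ p = 0 := fun p => by simp [convIntegrand]
  simp [this]

theorem IsConv.mem_distOnSubspace {g : r → 𝕜} {T : TempDist 𝕜 V} (hT : IsConv Λ Z F r g T)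
    {t : Submodule ℝ V} (hZ : ∀ a ∈ Z, a ∈ t) (hr : r ≤ t) : T ∈ distOnSubspace 𝕜 t := by
  refine mem_distOnSubspace_of_forall fun φ hφ => ?_
  rw [hT, convPairing, integral_convIntegrand_eq_zero (t := t) _ hr g hφ, mul_zero]
  intro z hz
  obtain ⟨a, ha, rfl⟩ := List.mem_map.1 hz
  exact t.smul_mem _ (hZ a ha)

theorem convPairing_nil {g : r → 𝕜} (hg : Continuous g) (φ : 𝓢(V, 𝕜)) :
    convPairing Λ [] F r g φ = densityPairing Λ r g φ := by
  rw [convPairing, densityPairing]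
  have : signedList ([] : List V) F = [] := rfl
  rw [this, integral_convIntegrand_nil g hg]
  simp

theorem IsConv.smul {g : r → 𝕜} {T : TempDist 𝕜 V}
    (hT : IsConv Λ Z F r g T) (c : 𝕜) : IsConv Λ Z F r (c • g) (c • T) := by
  intro φ
  change c • T φ = _
  rw [hT, convPairing, convPairing, smul_eq_mul, mul_left_comm, ← integral_const_mul]
  simp only [convIntegrand, Pi.smul_apply, smul_eq_mul, mul_left_comm]

variable [(latticeMeasure Λ r).IsAddHaarMeasure]

theorem exists_isConv (hu : ∀ a ∈ Z, 0 < faceSign F a * u a) (hur : ∀ y ∈ r, u y = 0)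
    {g : r → 𝕜} (hg : g ∈ polyFun 𝕜 r) : ∃ T : TempDist 𝕜 V, IsConv Λ Z F r g T := by
  classical
  obtain ⟨T, hT⟩ := exists_convDist (latticeMeasure Λ r) (signedList_pos hu) hur
    (hasTemperateGrowth_of_mem_polyFun hg)
  refine ⟨((-1 : 𝕜) ^ (Z.filter (fun a => ¬ ∀ u ∈ F, 0 < u a)).length) • T, fun φ => ?_⟩
  change ((-1 : 𝕜) ^ (Z.filter (fun a => ¬ ∀ u ∈ F, 0 < u a)).length) * T φ = _
  rw [hT, convPairing]

theorem convConverges (hu : ∀ a ∈ Z, 0 < faceSign F a * u a) (hur : ∀ y ∈ r, u y = 0)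
    {g : r → 𝕜} (hg : g ∈ polyFun 𝕜 r) (φ : 𝓢(V, 𝕜)) : ConvConverges Λ Z F r g φ :=
  integrable_convIntegrand (signedList_pos hu) hur (hasTemperateGrowth_of_mem_polyFun hg) φ

theorem IsConv.add (hu : ∀ a ∈ Z, 0 < faceSign F a * u a) (hur : ∀ y ∈ r, u y = 0)
    {g g' : r → 𝕜} (hg : g ∈ polyFun 𝕜 r) (hg' : g' ∈ polyFun 𝕜 r) {T T' : TempDist 𝕜 V}
    (hT : IsConv Λ Z F r g T) (hT' : IsConv Λ Z F r g' T') :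
    IsConv Λ Z F r (g + g') (T + T') := by
  intro φ
  change T φ + T' φ = _
  rw [hT, hT', convPairing, convPairing, convPairing, ← mul_add,
    ← integral_add (convConverges hu hur hg φ) (convConverges hu hur hg' φ)]
  simp only [convIntegrand, Pi.add_apply, mul_add]

theorem IsConv.distDeriv_cons {a : V} (hu : ∀ b ∈ a :: Z, 0 < faceSign F b * u b)
    (hur : ∀ y ∈ r, u y = 0) {g : r → 𝕜} (hg : g ∈ polyFun 𝕜 r) {T : TempDist 𝕜 V}
    (hT : IsConv Λ (a :: Z) F r g T) : IsConv Λ Z F r g (distDeriv 𝕜 a T) := by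
  intro φ
  have hpos := signedList_pos hu
  rw [signedList_cons] at hpos
  simp only [List.mem_cons, forall_eq_or_imp] at hpos
  have h := integral_convIntegrand_lineDeriv_cons (μ := latticeMeasure Λ r) hpos.1 hpos.2 hur
    (hasTemperateGrowth_of_mem_polyFun hg) φ
  rw [distDeriv_apply, hT, convPairing, convPairing, signedList_cons,
    neg_one_pow_length_filter_cons]
  rcases faceSign_eq_or F a with hs | hs
  · rw [hs, one_smul] at h ⊢
    rw [h]
    simp
  -- Here the spline contains `-a`, and the sign of `∂_{-a} = -∂_a` cancels against the factor `-1`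
  -- lost when `a` leaves the negative sublist.
  · rw [hs, neg_one_smul] at h ⊢
    have h2 : ∀ p, convIntegrand r g (∂_{-a} φ) p = -convIntegrand r g (∂_{a} φ) p := by
      intro p
      simp [convIntegrand, lineDerivOp_left_neg]
    simp only [h2, integral_neg, neg_inj] at h
    rw [h]
    simp

theorem IsConv.distDerivList_append {Y : List V}
    (hu : ∀ b ∈ Y ++ Z, 0 < faceSign F b * u b)
    (hur : ∀ y ∈ r, u y = 0) {g : r → 𝕜} (hg : g ∈ polyFun 𝕜 r) {T : TempDist 𝕜 V}
    (hT : IsConv Λ (Y ++ Z) F r g T) : IsConv Λ Z F r g (distDerivList 𝕜 Y T) := by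
  induction Y generalizing T with
  | nil => exact hT
  | cons a Y ih =>
    have h := ih (fun b hb => hu b (List.mem_cons_of_mem a hb)) (hT.distDeriv_cons hu hur hg)
    have h2 : distDerivList 𝕜 (a :: Y) T = distDerivList 𝕜 Y (distDeriv 𝕜 a T) := by
      have h3 : (a :: Y).Perm (Y ++ [a]) := List.perm_append_comm (l₁ := [a]) (l₂ := Y)
      rw [distDerivList_perm h3, SplineSeq.distDerivList_append, Module.End.mul_apply]
      simp [distDerivList_cons, distDerivList_nil]
    rwa [h2]

theorem IsConv.distDerivList_map (hu : ∀ b ∈ Z, 0 < faceSign F b * u b)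
    (hur : ∀ y ∈ r, u y = 0) {g : r → 𝕜} (hg : g ∈ polyFun 𝕜 r) {T : TempDist 𝕜 V}
    (hT : IsConv Λ Z F r g T) (Y : List r) :
    IsConv Λ Z F r (dirDerivList 𝕜 Y g)
      (distDerivList 𝕜 (Y.map (fun b : r => (b : V))) T) := by
  induction Y with
  | nil => exact hT
  | cons b Y ih =>
    intro φ
    rw [List.map_cons, distDerivList_cons, Module.End.mul_apply, distDeriv_apply, ih, convPairing,
      convPairing, integral_convIntegrand_lineDeriv (signedList_pos hu) hur
        (dirDerivList_mem hg Y), mul_neg, neg_neg]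
    rfl

/-- A continuous density is determined by its distribution. -/
theorem eq_zero_of_densityPairing {g : r → 𝕜} (hg : Continuous g)
    (h : ∀ φ : 𝓢(V, 𝕜), densityPairing Λ r g φ = 0) : g = 0 := by
  obtain ⟨E, hE⟩ := exists_extension (𝕜 := 𝕜) r
  have hae : ∀ᵐ y ∂(latticeMeasure Λ r), g y = 0 := by
    refine ae_eq_zero_of_integral_contDiff_smul_eq_zero hg.locallyIntegrable fun ψ hψ hc => ?_
    have hc' : HasCompactSupport (fun y : r => ((ψ y : ℝ) : 𝕜)) :=
      hc.comp_left RCLike.ofReal_zero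
    let Ψ : 𝓢(r, 𝕜) := hc'.toSchwartzMap ((RCLike.ofRealCLM (K := 𝕜)).contDiff.comp hψ)
    have h1 := h (E Ψ)
    rw [densityPairing] at h1
    rw [← h1]
    refine integral_congr_ae (Filter.Eventually.of_forall fun y => ?_)
    have h2 : E Ψ (y : V) = ((ψ y : ℝ) : 𝕜) := congrArg (fun f : 𝓢(r, 𝕜) => f y) (hE Ψ)
    simp only [h2, RCLike.real_smul_eq_coe_mul]
  exact (hg.ae_eq_iff_eq (latticeMeasure Λ r) continuous_zero).1 hae

end ConvolutionDistributions

/-! ### The filtration and its graded pieces -/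

section Filtration

variable {𝕜 : Type*} [RCLike 𝕜] {V : Type*} [NormedAddCommGroup V] [NormedSpace ℝ V]

theorem mem_spaceG {X : List V} {f : TempDist 𝕜 V} :
    f ∈ spaceG 𝕜 X ↔
      ∀ r, IsRational X r → distDerivList 𝕜 (listDiff X r) f ∈ distOnSubspace 𝕜 r := by
  simp [spaceG, Submodule.mem_iInf]

theorem mem_spaceGi {X : List V} {i : ℕ} {f : TempDist 𝕜 V} :
    f ∈ spaceGi 𝕜 X i ↔ f ∈ spaceG 𝕜 X ∧
      ∀ t, IsRational X t → Module.finrank ℝ t + 1 = i →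
        distDerivList 𝕜 (listDiff X t) f = 0 := by
  simp [spaceGi, Submodule.mem_iInf]

theorem distDerivList_eq_zero_of_perm_append {X Y Z : List V} (h : X.Perm (Y ++ Z))
    {f : TempDist 𝕜 V} (hf : distDerivList 𝕜 Z f = 0) : distDerivList 𝕜 X f = 0 := by
  rw [distDerivList_perm h, distDerivList_append, Module.End.mul_apply, hf, map_zero]

/-- A rational `t` of dimension `i - 1` is proper because `i ≤ dim V`, so it lies in a rational `t'`
of dimension `i`, and `∂_{X∖t}` is a multiple of `∂_{X∖t'}`. -/
theorem spaceGi_succ_le [FiniteDimensional ℝ V] {X : List V}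
    (hX : Submodule.span ℝ {a | a ∈ X} = ⊤) {i : ℕ} (hi : i ≤ Module.finrank ℝ V) :
    spaceGi 𝕜 X (i + 1) ≤ spaceGi 𝕜 X i := by
  intro f hf
  rw [mem_spaceGi] at hf ⊢
  refine ⟨hf.1, fun t ht hti => ?_⟩
  have hne : t ≠ ⊤ := by
    rintro rfl
    rw [finrank_top] at hti
    omega
  obtain ⟨t', ht', hle, hfin⟩ := ht.exists_step hX hne
  have h := listDiff_perm X t t'
  rw [listDiff_listDiff X hle] at h
  exact distDerivList_eq_zero_of_perm_append (h.trans List.perm_append_comm)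
    (hf.2 t' ht' (by omega))

variable [MeasurableSpace V] [BorelSpace V] [FiniteDimensional ℝ V]

/-- On `𝒢(X)_i` the operator `∂_{X ∖ r}` takes values in `D(X ∩ r)`. -/
theorem exists_polyD_isConv {X : List V} {i : ℕ} {f : TempDist 𝕜 V} (hf : f ∈ spaceGi 𝕜 X i)
    {r : Submodule ℝ V} (hr : IsRational X r) (hri : Module.finrank ℝ r = i) (Λ : Submodule ℤ V)
    (F : Set (StrongDual ℝ V)) [(latticeMeasure Λ r).IsAddHaarMeasure] :
    ∃ g ∈ polyD 𝕜 (listInter X r), IsConv Λ [] F r g (distDerivList 𝕜 (listDiff X r) f) := by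
  rw [mem_spaceGi, mem_spaceG] at hf
  obtain ⟨h, hh⟩ := mem_distOnSubspace_iff.1 (hf.1 r hr)
  have hcoc : ∀ Y, IsCocircuit (listInter X r) Y → distDerivList 𝕜 Y h = 0 := by
    rintro Y ⟨H, hH, hHfin, rfl⟩
    refine distPush_injective r ?_
    rw [distPush_distDerivList, hh, map_zero, ← Module.End.mul_apply, ← distDerivList_append,
      ← distDerivList_perm (listDiff_map_subtype_perm X H)]
    refine hf.2 _ (isRational_map_subtype hH) ?_
    rw [Submodule.finrank_map_subtype_eq, hHfin, hri]
  obtain ⟨g, hg, hgd⟩ := exists_polynomial_density (latticeMeasure Λ r)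
    (exists_pow_distDeriv_eq_zero (span_listInter hr) hcoc)
  have hcont : ∀ {g : r → 𝕜}, g ∈ polyFun 𝕜 r → Continuous g := fun hg =>
    (polyFun_aux hg).1.continuous
  -- The spline of the empty list is the Dirac measure at `0`, so `IsConv` with `[]` expresses that
  -- the distribution is the density `g`, whatever `F` is.
  have hconv : IsConv Λ [] F r g (distDerivList 𝕜 (listDiff X r) f) := by
    intro φ
    rw [convPairing_nil (hcont hg), ← hh, distPush_apply, hgd]
    rfl
  refine ⟨g, ⟨hg, fun Y hY => ?_⟩, hconv⟩
  -- The cocircuit equations pass from the distribution `h` to the function `g` because a continuous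
  -- density is determined by its distribution.
  refine eq_zero_of_densityPairing (Λ := Λ) (hcont (dirDerivList_mem hg Y)) fun φ => ?_
  have h1 := hconv.distDerivList_map (u := 0) (by simp) (by simp) hg Y φ
  rw [convPairing_nil (hcont (dirDerivList_mem hg Y)), ← hh, ← distPush_distDerivList,
    hcoc Y hY, map_zero] at h1
  exact h1.symm

variable {X : List V} {r t : Submodule ℝ V} {Λ : Submodule ℤ V} {F : Set (StrongDual ℝ V)}
  {u : StrongDual ℝ V} {g : r → 𝕜} {T : TempDist 𝕜 V} [(latticeMeasure Λ r).IsAddHaarMeasure]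

/-- Since `r ≤ t`, all vectors of `X∖t` occur in the spline list `X∖r` and are removed one by one.
-/
theorem IsConv.listBetween (hu : ∀ a ∈ listDiff X r, 0 < faceSign F a * u a)
    (hur : ∀ y ∈ r, u y = 0) (hg : g ∈ polyFun 𝕜 r) (hT : IsConv Λ (listDiff X r) F r g T)
    (hrt : r ≤ t) : IsConv Λ (listBetween X r t) F r g (distDerivList 𝕜 (listDiff X t) T) := by
  have h := listDiff_perm X r t
  rw [listDiff_listDiff X hrt] at h
  exact (hT.perm h).distDerivList_append (fun b hb => hu b (h.mem_iff.2 hb)) hur hg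

/-- The vectors of `X∩r` lying in `t` span a proper subspace of `r`, contained in a rational
hyperplane `H`. The cocircuit `(X∩r)∖H` then avoids `t`, so it is part of `X∖t`; its derivatives
fall on `g` and kill it. -/
theorem IsConv.distDerivList_eq_zero (hu : ∀ a ∈ listDiff X r, 0 < faceSign F a * u a)
    (hur : ∀ y ∈ r, u y = 0) (hr : IsRational X r) (hg : g ∈ polyD 𝕜 (listInter X r))
    (hT : IsConv Λ (listDiff X r) F r g T) (hrt : ¬ r ≤ t) :
    distDerivList 𝕜 (listDiff X t) T = 0 := by
  classical
  let U : Submodule ℝ r := Submodule.span ℝ {b | b ∈ listInter X r ∧ (b : V) ∈ t}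
  have hU : IsRational (listInter X r) U := IsRational.of_le_span (fun a ha => ha.1) rfl
  have hUt : U ≤ t.comap r.subtype := Submodule.span_le.2 fun b hb => hb.2
  have hne : U ≠ ⊤ := by
    intro h
    refine hrt fun y hy => ?_
    exact hUt (h ▸ Submodule.mem_top : (⟨y, hy⟩ : r) ∈ U)
  obtain ⟨H, hH, hUH, hfin⟩ := hU.exists_hyperplane (span_listInter hr) hne
  have hTY : IsConv Λ (listDiff X r) F r 0
      (distDerivList 𝕜 ((listDiff (listInter X r) H).map (fun b : r => (b : V))) T) := by
    rw [← hg.2 _ ⟨H, hH, hfin, rfl⟩]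
    exact hT.distDerivList_map hu hur hg.1 _
  have hsub : (listDiff (listInter X r) H).Sublist
      (List.filter (fun b : r => decide ((b : V) ∉ t)) (listInter X r)) := by
    have h1 : listDiff (listInter X r) H
        = (List.filter (fun b : r => decide ((b : V) ∉ t)) (listInter X r)).filter
          (fun b => decide (b ∉ H)) := by
      rw [listDiff, List.filter_filter]
      refine List.filter_congr fun b hb => ?_
      have h2 : (b : V) ∈ t → b ∈ H := fun hbt => hUH (Submodule.subset_span ⟨hb, hbt⟩)
      by_cases hbH : b ∈ H
      · simp [hbH]
      · simp [hbH, mt h2 hbH]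
    rw [h1]
    exact List.filter_sublist
  obtain ⟨L, hL⟩ : ∃ L, (listDiff X t).Perm
      (L ++ (listDiff (listInter X r) H).map (fun b : r => (b : V))) := by
    have h1 := hsub.map (fun b : r => (b : V))
    rw [map_coe_filter_listInter X r (fun a => a ∉ t)] at h1
    obtain ⟨L, hL⟩ := (h1.trans List.filter_sublist).exists_perm_append
    exact ⟨L, hL.trans List.perm_append_comm⟩
  exact distDerivList_eq_zero_of_perm_append hL hTY.eq_zero

theorem IsConv.mem_spaceGi {i : ℕ} (hu : ∀ a ∈ listDiff X r, 0 < faceSign F a * u a)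
    (hur : ∀ y ∈ r, u y = 0) (hr : r ∈ rationalSubspaces X i) (hg : g ∈ polyD 𝕜 (listInter X r))
    (hT : IsConv Λ (listDiff X r) F r g T) : T ∈ spaceGi 𝕜 X i := by
  rw [SplineSeq.mem_spaceGi, mem_spaceG]
  refine ⟨fun t ht => ?_, fun t ht hti => ?_⟩
  · by_cases hrt : r ≤ t
    · exact (hT.listBetween hu hur hg.1 hrt).mem_distOnSubspace
        (fun a ha => (mem_listBetween.1 ha).2.2) hrt
    · rw [hT.distDerivList_eq_zero hu hur hr.1 hg hrt]
      exact Submodule.zero_mem _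
  · refine hT.distDerivList_eq_zero hu hur hr.1 hg fun hrt => ?_
    have := Submodule.finrank_mono hrt
    have := hr.2
    omega

end Filtration

/-! ### The splitting -/

section Splitting

variable {𝕜 : Type*} [RCLike 𝕜] {V : Type*} [NormedAddCommGroup V] [NormedSpace ℝ V]
  [MeasurableSpace V] [BorelSpace V] [FiniteDimensional ℝ V]
  {Z : List V} {F : Set (StrongDual ℝ V)} {r : Submodule ℝ V} {u : StrongDual ℝ V}

/-- The convolution `g ↦ T_Z^F * g` on the space `D(Y)` as a linear map. -/
def convLinearMap (Λ : Submodule ℤ V) [(latticeMeasure Λ r).IsAddHaarMeasure] (Y : List r)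
    (hu : ∀ a ∈ Z, 0 < faceSign F a * u a) (hur : ∀ y ∈ r, u y = 0) :
    polyD 𝕜 Y →ₗ[𝕜] TempDist 𝕜 V where
  toFun g := (exists_isConv (Λ := Λ) hu hur g.2.1).choose
  map_add' g g' := (exists_isConv hu hur (g + g').2.1).choose_spec.unique
    ((exists_isConv hu hur g.2.1).choose_spec.add hu hur g.2.1 g'.2.1
      (exists_isConv hu hur g'.2.1).choose_spec)
  map_smul' c g := (exists_isConv hu hur (c • g).2.1).choose_spec.unique
    ((exists_isConv hu hur g.2.1).choose_spec.smul c)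

theorem isConv_convLinearMap (Λ : Submodule ℤ V) [(latticeMeasure Λ r).IsAddHaarMeasure]
    (Y : List r) (hu : ∀ a ∈ Z, 0 < faceSign F a * u a) (hur : ∀ y ∈ r, u y = 0)
    (g : polyD 𝕜 Y) : IsConv Λ Z F r (g : r → 𝕜) (convLinearMap Λ Y hu hur g) :=
  (exists_isConv (Λ := Λ) hu hur g.2.1).choose_spec

/-- A polynomial function on `r` regarded as a distribution on `V`. -/
def densityLinearMap (Λ : Submodule ℤ V) [(latticeMeasure Λ r).IsAddHaarMeasure] (Y : List r) :
    polyD 𝕜 Y →ₗ[𝕜] TempDist 𝕜 V :=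
  convLinearMap (Z := []) (F := ∅) (u := 0) Λ Y (by simp) (by simp)

theorem densityLinearMap_apply (Λ : Submodule ℤ V) [(latticeMeasure Λ r).IsAddHaarMeasure]
    (Y : List r) (g : polyD 𝕜 Y) (φ : 𝓢(V, 𝕜)) :
    densityLinearMap Λ Y g φ = densityPairing Λ r (g : r → 𝕜) φ := by
  rw [← convPairing_nil (F := ∅) (polyFun_aux g.2.1).1.continuous]
  exact isConv_convLinearMap Λ Y _ _ g φ

theorem densityLinearMap_injective (Λ : Submodule ℤ V)
    [(latticeMeasure Λ r).IsAddHaarMeasure] (Y : List r) :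
    Function.Injective (densityLinearMap (𝕜 := 𝕜) Λ Y) := by
  rw [← LinearMap.ker_eq_bot, LinearMap.ker_eq_bot']
  intro g hg
  refine Subtype.ext (eq_zero_of_densityPairing (Λ := Λ) (polyFun_aux g.2.1).1.continuous
    fun φ => ?_)
  rw [← densityLinearMap_apply, hg]
  rfl

/-- Because densities embed injectively into distributions, inverting the embedding on its range
makes the choice of the polynomial linear in `f`. -/
theorem exists_graded_map {X : List V} {i : ℕ} (hr : r ∈ rationalSubspaces X i)
    (Λ : Submodule ℤ V) [(latticeMeasure Λ r).IsAddHaarMeasure] :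
    ∃ m : spaceGi 𝕜 X i →ₗ[𝕜] polyD 𝕜 (listInter X r), ∀ f,
      densityLinearMap Λ (listInter X r) (m f) = distDerivList 𝕜 (listDiff X r) f := by
  let e := LinearEquiv.ofInjective _
    (densityLinearMap_injective (𝕜 := 𝕜) Λ (listInter X r))
  have hmem : ∀ f : spaceGi 𝕜 X i, (distDerivList 𝕜 (listDiff X r) ∘ₗ (spaceGi 𝕜 X i).subtype) f
      ∈ LinearMap.range (densityLinearMap (𝕜 := 𝕜) Λ (listInter X r)) := by
    intro f
    obtain ⟨g, hg, hconv⟩ := exists_polyD_isConv f.2 hr.1 hr.2 Λ ∅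
    exact ⟨⟨g, hg⟩, (isConv_convLinearMap Λ _ _ _ ⟨g, hg⟩).unique hconv⟩
  refine ⟨e.symm.toLinearMap ∘ₗ LinearMap.codRestrict _ _ hmem, fun f => ?_⟩
  exact congrArg Subtype.val (e.apply_symm_apply (LinearMap.codRestrict _ _ hmem f))

end Splitting

end SplineSeq

end SplineSpaces

theorem mainTheorem10 {𝕜 : Type*} [RCLike 𝕜]
    {V : Type*} [NormedAddCommGroup V] [NormedSpace ℝ V] [FiniteDimensional ℝ V]
    [MeasurableSpace V] [BorelSpace V]
    (Λ : Submodule ℤ V) [DiscreteTopology Λ] [IsZLattice ℝ Λ]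
    (X : List V) (hXΛ : ∀ a ∈ X, a ∈ Λ) (hX0 : ∀ a ∈ X, a ≠ 0)
    (hXspan : Submodule.span ℝ {a | a ∈ X} = ⊤)
    (i : ℕ) (hi : i ≤ Module.finrank ℝ V)
    (F : SplineSeq.rationalSubspaces X i → Set (StrongDual ℝ V))
    (hF : ∀ r, SplineSeq.IsRegularFace (SplineSeq.listDiff X r.1) (F r))
    (hFr : ∀ r, ∃ u ∈ F r, ∀ y ∈ r.1, u y = 0) :
    ∃ (hle : SplineSeq.spaceGi 𝕜 X (i + 1) ≤ SplineSeq.spaceGi 𝕜 X i)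
      (μ : SplineSeq.spaceGi 𝕜 X i →ₗ[𝕜]
        ((r : SplineSeq.rationalSubspaces X i) →
          SplineSeq.polyD 𝕜 (SplineSeq.listInter X r.1)))
      (P : ((r : SplineSeq.rationalSubspaces X i) →
          SplineSeq.polyD 𝕜 (SplineSeq.listInter X r.1)) →ₗ[𝕜] SplineSeq.spaceGi 𝕜 X i),
      -- `μ f = ⊕ ∂_{X ∖ r} f`, polynomial densities on `r` being regarded as distributions on `V`
      (∀ (f : SplineSeq.spaceGi 𝕜 X i) (r : SplineSeq.rationalSubspaces X i) (φ : 𝓢(V, 𝕜)),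
        SplineSeq.distDerivList 𝕜 (SplineSeq.listDiff X r.1) (f : SplineSeq.TempDist 𝕜 V) φ
          = SplineSeq.densityPairing Λ r.1 (μ f r : r.1 → 𝕜) φ) ∧
      -- `P (⊕ g_r) = ∑ T_{X ∖ r}^{F_r} * g_r`, the convolutions being well defined
      (∀ (g : (r : SplineSeq.rationalSubspaces X i) →
          SplineSeq.polyD 𝕜 (SplineSeq.listInter X r.1)) (φ : 𝓢(V, 𝕜)),
        (∀ r, SplineSeq.ConvConverges Λ (SplineSeq.listDiff X r.1) (F r) r.1
          (g r : r.1 → 𝕜) φ) ∧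
        (P g : SplineSeq.TempDist 𝕜 V) φ
          = ∑ r, SplineSeq.convPairing Λ (SplineSeq.listDiff X r.1) (F r) r.1
              (g r : r.1 → 𝕜) φ) ∧
      -- the sequence is exact
      Function.Injective (Submodule.inclusion hle) ∧
      Function.Exact (Submodule.inclusion hle) μ ∧
      Function.Surjective μ ∧
      -- `P` splits it
      μ ∘ₗ P = LinearMap.id := by
  classical
  choose u huF hur using hFr
  have hu : ∀ r : SplineSeq.rationalSubspaces X i, ∀ a ∈ SplineSeq.listDiff X r.1,
      0 < SplineSeq.faceSign (F r) a * u r a :=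
    fun r _ ha => SplineSeq.faceSign_mul_pos (hF r) (huF r) ha
  have hHaar (r : SplineSeq.rationalSubspaces X i) :
      (SplineSeq.latticeMeasure Λ r.1).IsAddHaarMeasure :=
    SplineSeq.isAddHaarMeasure_latticeMeasure hXΛ r.2.1
  choose m hm using fun r : SplineSeq.rationalSubspaces X i =>
    SplineSeq.exists_graded_map (𝕜 := 𝕜) r.2 Λ
  let C (r : SplineSeq.rationalSubspaces X i) :=
    SplineSeq.convLinearMap (𝕜 := 𝕜) Λ (SplineSeq.listInter X r.1) (hu r) (hur r)
  have hC (r : SplineSeq.rationalSubspaces X i) (g) :=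
    SplineSeq.isConv_convLinearMap (𝕜 := 𝕜) Λ (SplineSeq.listInter X r.1) (hu r) (hur r) g
  let S : ((r : SplineSeq.rationalSubspaces X i) →
      SplineSeq.polyD 𝕜 (SplineSeq.listInter X r.1)) →ₗ[𝕜] SplineSeq.TempDist 𝕜 V :=
    ∑ r, C r ∘ₗ LinearMap.proj r
  have hS (g) : S g = ∑ r, C r (g r) := by simp [S]
  have hle := SplineSeq.spaceGi_succ_le (𝕜 := 𝕜) hXspan hi
  let P := LinearMap.codRestrict (SplineSeq.spaceGi 𝕜 X i) S fun g => by
    rw [hS]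
    exact Submodule.sum_mem _ fun r _ => (hC r (g r)).mem_spaceGi (hu r) (hur r) r.2 (g r).2
  have hμP : LinearMap.pi m ∘ₗ P = LinearMap.id := by
    refine LinearMap.ext fun g => funext fun r => ?_
    refine SplineSeq.densityLinearMap_injective Λ _ ?_
    change SplineSeq.densityLinearMap Λ _ (m r (P g)) = SplineSeq.densityLinearMap Λ _ (g r)
    rw [hm]
    change SplineSeq.distDerivList 𝕜 (SplineSeq.listDiff X r.1) (S g) = _
    -- The summand of `r` returns `g r`, as no vector of `X∖r` lies in `r`; a different `s` of the
    -- same dimension is not contained in `r`, so its summand vanishes.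
    rw [hS, map_sum, Finset.sum_eq_single r]
    · have h := (hC r (g r)).listBetween (hu r) (hur r) (g r).2.1 le_rfl
      rw [SplineSeq.listBetween_self] at h
      ext φ
      rw [h, SplineSeq.convPairing_nil (SplineSeq.polyFun_aux (g r).2.1).1.continuous,
        SplineSeq.densityLinearMap_apply]
    · intro s _ hsr
      refine (hC s (g s)).distDerivList_eq_zero (hu s) (hur s) s.2.1 (g s).2 fun hsr' => hsr ?_
      exact Subtype.ext (Submodule.eq_of_le_of_finrank_eq hsr' (s.2.2.trans r.2.2.symm))
    · exact fun h => absurd (Finset.mem_univ r) h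
  refine ⟨hle, LinearMap.pi m, P, fun f r φ => ?_, fun g φ => ⟨fun r => ?_, ?_⟩,
    Submodule.inclusion_injective hle, fun f => ?_, ?_, hμP⟩
  · rw [← hm, SplineSeq.densityLinearMap_apply]
    rfl
  · exact SplineSeq.convConverges (hu r) (hur r) (g r).2.1 φ
  · change S g φ = _
    rw [hS]
    let ev : SplineSeq.TempDist 𝕜 V →+ 𝕜 := ⟨⟨fun T => T φ, rfl⟩, fun _ _ => rfl⟩
    exact (map_sum ev _ _).trans (Finset.sum_congr rfl fun r _ => hC r (g r) φ)
  · rw [Set.mem_range]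
    constructor
    · intro h
      refine ⟨⟨f, SplineSeq.mem_spaceGi.2 ⟨(SplineSeq.mem_spaceGi.1 f.2).1, ?_⟩⟩, rfl⟩
      intro t ht hti
      have h1 := congrFun h ⟨t, ht, Nat.succ_injective hti⟩
      have h2 := hm ⟨t, ht, Nat.succ_injective hti⟩ f
      change m _ f = 0 at h1
      rw [h1, map_zero] at h2
      exact h2.symm
    · rintro ⟨f', rfl⟩
      refine funext fun r => SplineSeq.densityLinearMap_injective Λ _ ?_
      change SplineSeq.densityLinearMap Λ _ (m r _) = SplineSeq.densityLinearMap Λ _ 0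
      rw [hm, map_zero, Submodule.coe_inclusion]
      exact (SplineSeq.mem_spaceGi.1 f'.2).2 r.1 r.2.1 (by rw [r.2.2])
  · exact Function.LeftInverse.surjective (LinearMap.congr_fun hμP)
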